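/- Setting. Fix $\beta>1$, $T>0$ and points $0\le b_1<\dots<b_k<1$ of the torus $\mathbb T=[0,1)$; put $b_{k+1}=b_1+1$. Let $\mathbb T_N=\{1,\dots,N\}$ be the discrete torus. Consider the Markov process $(\eta_t)_{t\ge 0}$ on $\{0,1\}^{\mathbb T_N}$ with generator $N^2\mathcal L_N$, where $$\mathcal L_Nf(\eta)=\sum_{x\in\mathbb T_N}\xi^N_{x,x+1}\,[f(\eta^{x,x+1})-f(\eta)],$$ $\eta^{x,x+1}$ is $\eta$ with the values at $x$ and $x+1$ exchanged, $\xi^N_{x,x+1}=N^{-\beta}$ if $(\frac xN,\frac{x+1}N]$ contains (modulo 1) one of the points $b_i$, and $\xi^N_{x,x+1}=1$ otherwise. Let $\gamma:\mathbb T\to[0,1]$ be continuous, and let the initial laws $\mu_N$ be associated to $\gamma$: for every $H\in C(\mathbb T)$ and $\delta>0$, $\mu_N\{|\frac1N\sum_x H(\frac xN)\eta(x)-\int_{\mathbb T} H\gamma\,du|>\delta\}\to0$. Let $\mathcal M$ be the space of positive measures on $\mathbb T$ of total mass at most $1$ with the weak topology, let $\pi^N_t=\frac1N\sum_x\eta_t(x)\delta_{x/N}$,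 and let $\mathbb Q_N$ be the law of $(\pi^N_t)_{0\le t\le T}$ on $D([0,T],\mathcal M)$ with the Skorohod topology. Let $\mathbb Q_*$ be a limit point, that is, a weak limit of a subsequence, of $(\mathbb Q_N)$. Let $\mathcal C$ be the set of $H\in C^{0,1}([0,T]\times\mathbb T)$ (continuous, with $\partial_uH$ existing and continuous) whose closed support is contained in $[0,T]\times(\mathbb T\setminus\{b_1,\dots,b_k\})$. For $\alpha\in(0,1)$ let $\nu_\alpha$ be the Bernoulli product measure of density $\alpha$ on $\{0,1\}^{\mathbb T_N}$, and call $K_0$ an entropy constant for $\alpha$ if the relative entropy satisfies $H_N(\mu|\nu_\alpha)\le K_0N$ for all $N\ge1$ and all probability measures $\mu$ on $\{0,1\}^{\mathbb T_N}$. Claim. $\mathbb Q_*$ is concentrated on paths $\pi_t(du)=\rho(t,u)\,du$, $0\le t\le T$, with $\rho=\rho^\pi:[0,T]\times\mathbb T\to[0,1]$ measurable, such that: (i) there is $\partial_u\rho\in L^2([0,T]\times\mathbb T)$ with $$\int_0^T\!\!\int_{\mathbb T}\partial_uH\,\rho\,du\,ds=-\int_0^T\!\!\int_{\mathbb T}H\,\partial_u\rho\,du\,ds\qquad\text{for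 all }H\in\mathcal C;$$ (ii) for each $i=1,\dots,k$, $\rho\in L^2(0,T;\mathcal H^1(b_i,b_{i+1}))$: that is, $\rho\in L^2([0,T]\times[b_i,b_{i+1}])$, and there is a function $g\in L^2([0,T]\times[b_i,b_{i+1}])$ such that $\int_0^T\!\int_{b_i}^{b_{i+1}}\partial_uH\,\rho\,du\,ds=-\int_0^T\!\int_{b_i}^{b_{i+1}}H\,g\,du\,ds$ for all $H$ of class $C^{0,1}$ with compact support in $[0,T]\times(b_i,b_{i+1})$. Moreover, $\mathcal E(\pi)=\sup_{H\in\mathcal C}\big\{\int_0^T\!\int_{\mathbb T}\partial_uH\,\rho^\pi\,du\,ds-2\int_0^T\!\int_{\mathbb T}H^2\,du\,ds\big\}\in[0,\infty]$ is $\mathbb Q_*$-almost everywhere measurable and, for every $\alpha\in(0,1)$, an entropy constant exists and $$E_{\mathbb Q_*}[\mathcal E]\le K_0\qquad\text{for every entropy constant }K_0\text{ for }\alpha.$$ -/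

import Mathlib

open MeasureTheory ProbabilityTheory Filter Topology Set
open scoped NNReal ENNReal

namespace SlowBond

noncomputable section

/-! ### The exclusion process with slow bonds -/

/-- Configurations `η ∈ {0,1}^{𝕋_N}`; `η x = true` means that the site `x` is occupied. -/
abbrev Config (N : ℕ) : Type := ZMod N → Bool

/-- The occupation number `η(x) ∈ {0,1}`. -/
def occ {N : ℕ} (η : Config N) (x : ZMod N) : ℝ := if η x then 1 else 0

/-- `η^{x,x+1}`: the values of `η` at `x` and `x+1` are exchanged. -/
def exchange {N : ℕ} (x : ZMod N) (η : Config N) : Config N :=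
  fun y => η (Equiv.swap x (x + 1) y)

/-- The bond `{x, x+1}` is slow: the arc `(x/N, (x+1)/N]` of the torus contains some `b i`. -/
def IsSlow {k : ℕ} (b : Fin k → ℝ) {N : ℕ} (x : ZMod N) : Prop :=
  ∃ i, (b i : UnitAddCircle) ∈
    (fun r : ℝ => (r : UnitAddCircle)) '' Ioc ((x.val : ℝ) / N) (((x.val : ℝ) + 1) / N)

open Classical in
/-- The conductance `ξ^N_{x,x+1}`. -/
def conductance {k : ℕ} (β : ℝ) (b : Fin k → ℝ) {N : ℕ} (x : ZMod N) : ℝ :=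
  if IsSlow b x then (N : ℝ) ^ (-β) else 1

/-- The generator `L_N f(η) = ∑ₓ ξ_{x,x+1} [f(η^{x,x+1}) - f(η)]`. -/
def generator {k : ℕ} (β : ℝ) (b : Fin k → ℝ) (N : ℕ) [NeZero N] :
    (Config N → ℝ) →ₗ[ℝ] (Config N → ℝ) where
  toFun f η := ∑ x : ZMod N, conductance β b x * (f (exchange x η) - f η)
  map_add' f g := by
    funext η
    simp only [Pi.add_apply, ← Finset.sum_add_distrib]
    exact Finset.sum_congr rfl fun x _ => by ring
  map_smul' c f := by
    funext η
    simp only [Pi.smul_apply, smul_eq_mul, RingHom.id_apply, Finset.mul_sum]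
    exact Finset.sum_congr rfl fun x _ => by ring

/-- The semigroup `exp(t N² L_N)` of the process speeded up by `N²`. -/
def semigroup {k : ℕ} (β : ℝ) (b : Fin k → ℝ) (N : ℕ) [NeZero N] (t : ℝ) :
    (Config N → ℝ) →L[ℝ] (Config N → ℝ) :=
  NormedSpace.exp ((t * (N : ℝ) ^ 2) • LinearMap.toContinuousLinearMap (generator β b N))

/-- Transition probabilities `p_t(η, ζ)` of the process speeded up by `N²`. -/
def transition {k : ℕ} (β : ℝ) (b : Fin k → ℝ) (N : ℕ) [NeZero N] (t : ℝ)
    (η ζ : Config N) : ℝ :=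
  semigroup β b N t (Pi.single ζ 1) η

/-- Right-continuous paths with left limits. -/
def IsCadlag {ι E : Type*} [TopologicalSpace ι] [Preorder ι] [TopologicalSpace E]
    (x : ι → E) : Prop :=
  ∀ t, ContinuousWithinAt x (Ici t) t ∧ ∃ l, Tendsto x (𝓝[<] t) (𝓝 l)

/-- The path space `D(ℝ₊, {0,1}^{𝕋_N})`, with the `σ`-algebra generated by the evaluations. -/
abbrev ConfigPath (N : ℕ) : Type := {ω : ℝ≥0 → Config N // IsCadlag ω}

/-- `P` is the law on `D(ℝ₊, {0,1}^{𝕋_N})` of the Markov process with generator `N² L_N` and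
initial distribution `μ`, given by its finite-dimensional distributions. -/
structure IsExclusionLaw {k : ℕ} (β : ℝ) (b : Fin k → ℝ) (N : ℕ) [NeZero N]
    (μ : Measure (Config N)) (P : Measure (ConfigPath N)) : Prop where
  isProbabilityMeasure : IsProbabilityMeasure P
  finite_dim : ∀ (n : ℕ) (t : Fin (n + 1) → ℝ≥0) (ζ : Fin (n + 1) → Config N),
    Monotone t → t 0 = 0 →
    P {ω | ∀ i, ω.1 (t i) = ζ i} = μ {ζ 0} *
      ∏ i : Fin n, ENNReal.ofReal
        (transition β b N ((t i.succ : ℝ) - (t i.castSucc : ℝ)) (ζ i.castSucc) (ζ i.succ))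

/-- The measures `μ_N` on `{0,1}^{𝕋_N}` are associated to the profile `γ`. -/
def IsAssociated (μ : ∀ N : ℕ+, Measure (Config N)) (γ : UnitAddCircle → ℝ) : Prop :=
  ∀ δ : ℝ, 0 < δ → ∀ H : C(UnitAddCircle, ℝ),
    Tendsto (fun N : ℕ+ => μ N {η | δ < |(1 / (N : ℝ)) *
        ∑ x : ZMod N, H (ZMod.toAddCircle x) * occ η x - ∫ u, H u * γ u|})
      atTop (𝓝 0)

/-! ### The Bernoulli product measures and the entropy bound -/

/-- The Bernoulli product measure `ν_α` on `{0,1}^{𝕋_N}`. -/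
def bernoulliProduct (α : ℝ) (N : ℕ) [NeZero N] : Measure (Config N) :=
  Measure.pi fun _ =>
    ENNReal.ofReal α • Measure.dirac true + ENNReal.ofReal (1 - α) • Measure.dirac false

/-- `K₀` is a constant for which the relative entropy with respect to `ν_α` satisfies
`H_N(μ | ν_α) ≤ K₀ N` for all `N ≥ 1` and all probability measures `μ` on `{0,1}^{𝕋_N}`. -/
def IsEntropyConstant (α K₀ : ℝ) : Prop :=
  ∀ (N : ℕ+) (μ : Measure (Config N)), IsProbabilityMeasure μ →
    InformationTheory.klDiv μ (bernoulliProduct α N) ≤ ENNReal.ofReal (K₀ * (N : ℝ))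

/-! ### The Skorohod space -/

/-- The space `𝓜` of positive measures on the torus with total mass at most one. -/
def SubProb : Type := {ν : FiniteMeasure UnitAddCircle // ν.mass ≤ 1}

/-- The weak topology on `𝓜`. -/
instance : TopologicalSpace SubProb :=
  inferInstanceAs (TopologicalSpace {ν : FiniteMeasure UnitAddCircle // ν.mass ≤ 1})

/-- The measure underlying an element of `𝓜`. -/
def SubProb.toMeasure (ν : SubProb) : Measure UnitAddCircle := (ν.1 : Measure UnitAddCircle)

/-- Integration of continuous functions against an element of `𝓜`. -/
def SubProb.pairing (ν : SubProb) (f : C(UnitAddCircle, ℝ)) : ℝ := ∫ u, f u ∂ν.toMeasure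

theorem SubProb.topology_eq :
    (inferInstance : TopologicalSpace SubProb) =
      (UniformSpace.comap SubProb.pairing inferInstance).toTopologicalSpace := by
  have h1 : IsInducing SubProb.pairing := by
    refine isInducing_iff_nhds.2 fun ν => le_antisymm ?_ ?_
    · rw [← tendsto_iff_comap]
      refine tendsto_pi_nhds.2 fun f => ?_
      have h2 : Tendsto (fun ν : SubProb => ν.1) (𝓝 ν) (𝓝 ν.1) :=
        (continuous_subtype_val (p := fun ν : FiniteMeasure UnitAddCircle => ν.mass ≤ 1)).tendsto ν
      exact (FiniteMeasure.tendsto_iff_forall_integral_tendsto.1 h2)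
        (BoundedContinuousFunction.mkOfCompact f)
    · have h3 : IsInducing (fun ν : SubProb => ν.1) :=
        IsInducing.subtypeVal (t := {ν : FiniteMeasure UnitAddCircle | ν.mass ≤ 1})
      rw [h3.nhds_eq_comap, ← tendsto_iff_comap]
      refine FiniteMeasure.tendsto_iff_forall_integral_tendsto.2 fun f => ?_
      have h4 : Tendsto SubProb.pairing (comap SubProb.pairing (𝓝 ν.pairing)) (𝓝 ν.pairing) :=
        tendsto_comap
      exact (tendsto_pi_nhds.1 h4) f.toContinuousMap
  exact h1.eq_induced

/-- The uniform structure on `𝓜` of convergence against continuous functions. The underlying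
topology is the weak topology. -/
instance : UniformSpace SubProb :=
  (UniformSpace.comap SubProb.pairing inferInstance).replaceTopology SubProb.topology_eq

/-- The space `D([0,T], E)` of càdlàg paths. -/
def SkorohodSpace (T : ℝ) (E : Type*) [TopologicalSpace E] : Type _ :=
  {x : Icc (0 : ℝ) T → E // IsCadlag x}

/-- `x` and `y` are close in the Skorohod sense: for some increasing bijection `r` of `[0,T]` with
`sup |r t - t| ≤ ε`, the points `x (r t)` and `y t` are `V`-close for all `t`. -/
def skorohodRel {T : ℝ} {E : Type*} [UniformSpace E] (ε : ℝ) (V : Set (E × E)) :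
    Set (SkorohodSpace T E × SkorohodSpace T E) :=
  {p | ∃ r : Icc (0 : ℝ) T ≃o Icc (0 : ℝ) T,
    (∀ t, |(r t : ℝ) - t| ≤ ε) ∧ ∀ t, (p.1.1 (r t), p.2.1 t) ∈ V}

/-- The sets `skorohodRel ε V`, for `ε > 0` and `V` an entourage, form a filter basis. -/
def skorohodBasis (T : ℝ) (E : Type*) [UniformSpace E] :
    FilterBasis (SkorohodSpace T E × SkorohodSpace T E) where
  sets := {S | ∃ ε : ℝ, 0 < ε ∧ ∃ V ∈ uniformity E, S = skorohodRel ε V}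
  nonempty := ⟨_, 1, one_pos, univ, univ_mem, rfl⟩
  inter_sets := by
    rintro _ _ ⟨ε, hε, V, hV, rfl⟩ ⟨ε', hε', V', hV', rfl⟩
    refine ⟨_, ⟨min ε ε', lt_min hε hε', V ∩ V', inter_mem hV hV', rfl⟩, ?_⟩
    rintro p ⟨r, h1, h2⟩
    exact ⟨⟨r, fun t => (h1 t).trans (min_le_left _ _), fun t => (h2 t).1⟩,
      ⟨r, fun t => (h1 t).trans (min_le_right _ _), fun t => (h2 t).2⟩⟩

/-- The (`J₁`) Skorohod topology on `D([0,T], E)`. -/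
instance (T : ℝ) (E : Type*) [UniformSpace E] : UniformSpace (SkorohodSpace T E) :=
  UniformSpace.ofCore <| UniformSpace.Core.mkOfBasis (skorohodBasis T E)
    (by
      rintro _ ⟨ε, hε, V, hV, rfl⟩ x
      exact ⟨OrderIso.refl _, fun t => by simpa using hε.le, fun t => refl_mem_uniformity hV⟩)
    (by
      rintro _ ⟨ε, hε, V, hV, rfl⟩
      refine ⟨_, ⟨ε, hε, Prod.swap ⁻¹' V, symm_le_uniformity hV, rfl⟩, ?_⟩
      rintro p ⟨r, h1, h2⟩
      refine ⟨r.symm, fun t => ?_, fun t => ?_⟩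
      · have := h1 (r.symm t)
        rw [OrderIso.apply_symm_apply, abs_sub_comm] at this
        exact this
      · have := h2 (r.symm t)
        rw [OrderIso.apply_symm_apply] at this
        exact this)
    (by
      rintro _ ⟨ε, hε, V, hV, rfl⟩
      obtain ⟨W, hW, hWV⟩ := comp_mem_uniformity_sets hV
      refine ⟨_, ⟨ε / 2, half_pos hε, W, hW, rfl⟩, ?_⟩
      rintro ⟨x, z⟩ ⟨y, ⟨r, h1, h2⟩, ⟨q, h3, h4⟩⟩
      refine ⟨q.trans r, fun t => ?_, fun t => hWV ⟨y.1 (q t), h2 (q t), h4 t⟩⟩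
      have e1 := h1 (q t)
      have e2 := h3 t
      have e3 := abs_sub_le ((r (q t) : Icc (0 : ℝ) T) : ℝ) (q t : ℝ) (t : ℝ)
      simp only [OrderIso.trans_apply]
      linarith)

instance (T : ℝ) (E : Type*) [UniformSpace E] : MeasurableSpace (SkorohodSpace T E) := borel _

instance (T : ℝ) (E : Type*) [UniformSpace E] : BorelSpace (SkorohodSpace T E) := ⟨rfl⟩

/-! ### The empirical process -/

/-- The empirical measure `N⁻¹ ∑ₓ η(x) δ_{x/N}`, as a measure. -/
def empiricalMeasure {N : ℕ} [NeZero N] (η : Config N) : Measure UnitAddCircle :=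
  (N : ℝ≥0∞)⁻¹ • ∑ x : ZMod N, if η x then Measure.dirac (ZMod.toAddCircle x) else 0

theorem empiricalMeasure_univ_le {N : ℕ} [NeZero N] (η : Config N) :
    empiricalMeasure η univ ≤ 1 := by
  have h : ∀ x : ZMod N,
      (if η x then Measure.dirac (ZMod.toAddCircle x) else 0 : Measure UnitAddCircle) univ ≤ 1 := by
    intro x
    split_ifs <;> simp
  have hN : (N : ℝ≥0∞) ≠ 0 := by exact_mod_cast NeZero.ne N
  calc empiricalMeasure η univ
      = (N : ℝ≥0∞)⁻¹ * ∑ x : ZMod N,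
        (if η x then Measure.dirac (ZMod.toAddCircle x) else 0 : Measure UnitAddCircle) univ := by
        simp [empiricalMeasure, Measure.finsetSum_apply]
    _ ≤ (N : ℝ≥0∞)⁻¹ * ∑ _x : ZMod N, 1 := by
        gcongr with x
        exact h x
    _ = 1 := by
        simp [ZMod.card, ENNReal.inv_mul_cancel hN (ENNReal.natCast_ne_top N)]

/-- The empirical measure as an element of `𝓜`. -/
def empirical {N : ℕ} [NeZero N] (η : Config N) : SubProb :=
  ⟨⟨empiricalMeasure η, ⟨(empiricalMeasure_univ_le η).trans_lt ENNReal.one_lt_top⟩⟩,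
    ENNReal.toNNReal_mono ENNReal.one_ne_top (empiricalMeasure_univ_le η)⟩

/-- The map `η_· ↦ (π^N_t)_{0 ≤ t ≤ T}` from `D(ℝ₊, {0,1}^{𝕋_N})` to `D([0,T], 𝓜)`. -/
def empiricalPath (N : ℕ) [NeZero N] (T : ℝ) (ω : ConfigPath N) : SkorohodSpace T SubProb :=
  ⟨fun t => empirical (ω.1 ⟨t, t.2.1⟩), by
    have hc : Continuous (empirical : Config N → SubProb) := continuous_of_discreteTopology
    have hi : Continuous fun t : Icc (0 : ℝ) T => (⟨t, t.2.1⟩ : ℝ≥0) :=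
      Continuous.subtype_mk continuous_subtype_val _
    intro t
    obtain ⟨h1, l, h2⟩ := ω.2 ⟨t, t.2.1⟩
    refine ⟨?_, empirical l, ?_⟩
    · refine (hc.tendsto _).comp (h1.tendsto.comp ?_)
      exact tendsto_nhdsWithin_of_tendsto_nhds_of_eventually_within _
        (hi.continuousWithinAt.tendsto) (eventually_mem_nhdsWithin.mono fun s hs => hs)
    · refine (hc.tendsto _).comp (h2.comp ?_)
      exact tendsto_nhdsWithin_of_tendsto_nhds_of_eventually_within _
        (hi.continuousWithinAt.tendsto) (eventually_mem_nhdsWithin.mono fun s hs => hs)⟩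

/-! ### Test functions, energy and Sobolev spaces -/

/-- The space-time domain `[0,T] × 𝕋`. -/
abbrev Cylinder (T : ℝ) : Type := Icc (0 : ℝ) T × UnitAddCircle

/-- Lebesgue measure on `[0,T]`. -/
def timeMeasure (T : ℝ) : Measure (Icc (0 : ℝ) T) := Measure.comap Subtype.val volume

/-- Lebesgue measure `ds du` on `[0,T] × 𝕋`. -/
def cylinderMeasure (T : ℝ) : Measure (Cylinder T) := (timeMeasure T).prod volume

/-- Lebesgue measure `ds du` on `[0,T] × [a,c]`. -/
def stripMeasure (T a c : ℝ) : Measure (Icc (0 : ℝ) T × ℝ) :=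
  (timeMeasure T).prod (volume.restrict (Icc a c))

/-- The torus points `{b_1, …, b_k}`. -/
def slowPoints {k : ℕ} (b : Fin k → ℝ) : Set UnitAddCircle :=
  range fun i => (b i : UnitAddCircle)

/-- Functions `H ∈ C^{0,1}([0,T] × 𝕋)`, with space derivative `dH`, whose (closed) support is
contained in `[0,T] × (𝕋 ∖ B)`. -/
structure TorusTest (T : ℝ) (B : Set UnitAddCircle) where
  H : Cylinder T → ℝ
  dH : Cylinder T → ℝ
  continuous_H : Continuous H
  continuous_dH : Continuous dH
  hasDerivAt : ∀ (t : Icc (0 : ℝ) T) (u : ℝ),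
    HasDerivAt (fun v : ℝ => H (t, (v : UnitAddCircle))) (dH (t, (u : UnitAddCircle))) u
  support : tsupport H ⊆ univ ×ˢ Bᶜ

/-- `g` is a weak space derivative of `ρ` in `L²([0,T] × 𝕋)`, tested against functions with support
in `[0,T] × (𝕋 ∖ B)`. -/
def IsWeakDeriv {T : ℝ} (B : Set UnitAddCircle) (ρ g : Cylinder T → ℝ) : Prop :=
  MemLp g 2 (cylinderMeasure T) ∧ ∀ φ : TorusTest T B,
    ∫ p, φ.dH p * ρ p ∂cylinderMeasure T = -∫ p, φ.H p * g p ∂cylinderMeasure T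

/-- The energy `sup_H {∫∫ ∂_u H ρ - 2 ∫∫ H²}`. As `H = 0` is allowed, the supremum is
nonnegative and may be computed in `[0,∞]`. -/
def energy {T : ℝ} (B : Set UnitAddCircle) (ρ : Cylinder T → ℝ) : ℝ≥0∞ :=
  ⨆ φ : TorusTest T B, ENNReal.ofReal
    ((∫ p, φ.dH p * ρ p ∂cylinderMeasure T) - 2 * ∫ p, φ.H p ^ 2 ∂cylinderMeasure T)

/-- Functions `H` of class `C^{0,1}` with compact support in `[0,T] × (a,c)` (extended by zero to
`[0,T] × ℝ`), with space derivative `dH`. -/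
structure IntervalTest (T a c : ℝ) where
  H : Icc (0 : ℝ) T × ℝ → ℝ
  dH : Icc (0 : ℝ) T × ℝ → ℝ
  continuous_H : Continuous H
  continuous_dH : Continuous dH
  hasDerivAt : ∀ (t : Icc (0 : ℝ) T) (u : ℝ), HasDerivAt (fun v : ℝ => H (t, v)) (dH (t, u)) u
  compactSupport : HasCompactSupport H
  support : tsupport H ⊆ univ ×ˢ Ioo a c

/-- `ϱ` belongs to `L²(0,T; H¹(a,c))`. -/
def MemL2H1 (T a c : ℝ) (ϱ : Icc (0 : ℝ) T × ℝ → ℝ) : Prop :=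
  MemLp ϱ 2 (stripMeasure T a c) ∧
  ∃ g : Icc (0 : ℝ) T × ℝ → ℝ, MemLp g 2 (stripMeasure T a c) ∧
    ∀ φ : IntervalTest T a c,
      ∫ p, φ.dH p * ϱ p ∂stripMeasure T a c = -∫ p, φ.H p * g p ∂stripMeasure T a c

/-- The right end point `b_{i+1}` of the interval that starts at `b_i`; the last interval
ends at `b_1 + 1`, which is the point `b_1` of the torus. -/
def nextPoint {k : ℕ} (b : Fin k → ℝ) (i : Fin k) : ℝ :=
  if h : (i : ℕ) + 1 < k then b ⟨i + 1, h⟩ else b ⟨0, i.pos⟩ + 1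

/-- `ρ : [0,T] × 𝕋 → [0,1]` is measurable and `π_t(du) = ρ(t,u) du` for all `t ∈ [0,T]`. -/
def IsDensity {T : ℝ} (π : SkorohodSpace T SubProb) (ρ : Cylinder T → ℝ) : Prop :=
  Measurable ρ ∧ (∀ p, ρ p ∈ Icc (0 : ℝ) 1) ∧
    ∀ t, (π.1 t).toMeasure = volume.withDensity fun u => ENNReal.ofReal (ρ (t, u))

end

end SlowBond

namespace SlowBond

noncomputable section

/-! ### Entropy constants -/

/-! The dynamics is symmetric, so counting measure on configurations is reversible. For a test
function `H` vanishing near the slow points, consider the potential `∑ₓ N (H(x+1) - H(x)) η(x) - ½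
∑ₓ H(x)²`. Summation by parts puts its linear term on bonds. For large `N` the slow bonds get
coefficient zero, and on the other bonds Young's inequality absorbs the linear term into the
Dirichlet form (`discreteDerivative_add_dirichlet_nonpos`). Generator plus potential is thus a
nonpositive quadratic form. A discretized Feynman-Kac formula then bounds the exponential moment of
the time integral of the potential by `2^N` (`lintegral_exp_integral_le`), whatever the initial law:
any initial law is dominated by counting measure, whose mass is `2^N`.

Taking logarithms, dividing by `N` and applying Jensen, the expected maximum of finitely many energy
functionals is at most `log 2 + o(1)`. These functionals are bounded and continuous in the Skorohod
topology, so the bound passes to the limit point. Separability and monotone convergence extend it to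
the full supremum (`lintegral_pathEnergy_le`). Every entropy constant is at least `log 2`
(`IsEntropyConstant.log_two_le`), which gives the stated bound.

A site holds at most one particle, so limiting paths are dominated by Lebesgue measure and have
densities in `[0,1]` (`ae_toMeasure_le_volume`, `exists_isDensity`). Finite energy bounds `H ↦ ∫∫
∂_u H ρ` in `L²` norm, and Riesz representation yields the weak derivative
(`IsDensity.exists_isWeakDeriv`). Periodizing tests on an interval `(b_i, b_{i+1})` transfers it to
that interval (`IsDensity.memL2H1`). -/

theorem isProbabilityMeasure_coin {α : ℝ} (hα : α ∈ Ioo (0 : ℝ) 1) : IsProbabilityMeasure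
    (ENNReal.ofReal α • Measure.dirac true + ENNReal.ofReal (1 - α) • Measure.dirac false) := by
  constructor
  simp only [Measure.coe_add, Measure.coe_smul, Pi.add_apply, Pi.smul_apply, measure_univ,
    smul_eq_mul, mul_one]
  rw [← ENNReal.ofReal_add hα.1.le (by linarith [hα.2])]
  simp

theorem bernoulliProduct_singleton {α : ℝ} (hα : α ∈ Ioo (0 : ℝ) 1) (N : ℕ) [NeZero N]
    (η : Config N) :
    bernoulliProduct α N {η} = ENNReal.ofReal (∏ x, if η x then α else 1 - α) := by
  have := isProbabilityMeasure_coin hα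
  have h1 : ∀ x, (0 : ℝ) ≤ if η x then α else 1 - α := by
    intro x
    split_ifs
    · exact hα.1.le
    · linarith [hα.2]
  rw [bernoulliProduct, Measure.pi_singleton, ENNReal.ofReal_prod_of_nonneg fun x _ => h1 x]
  refine Finset.prod_congr rfl fun x _ => ?_
  cases h : η x <;> simp

theorem isProbabilityMeasure_bernoulliProduct {α : ℝ} (hα : α ∈ Ioo (0 : ℝ) 1) (N : ℕ)
    [NeZero N] : IsProbabilityMeasure (bernoulliProduct α N) := by
  have := isProbabilityMeasure_coin hα
  unfold bernoulliProduct
  infer_instance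

/-- On a finite space, a probability measure with `1 ≤ C ν{a}` for all `a` bounds the relative
entropy of every probability measure by `log C`. -/
theorem klDiv_le_log_of_singleton {S : Type*} [Finite S] [MeasurableSpace S]
    [MeasurableSingletonClass S] (μ ν : Measure S) [IsProbabilityMeasure μ]
    [IsProbabilityMeasure ν] {C : ℝ} (hC : ∀ a, 1 ≤ ENNReal.ofReal C * ν {a}) :
    InformationTheory.klDiv μ ν ≤ ENNReal.ofReal (Real.log C) := by
  have hne : ∀ a, ν {a} ≠ 0 := fun a h => by simpa [h] using hC a
  have hac : μ ≪ ν := by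
    refine Measure.AbsolutelyContinuous.mk fun s _ hs => ?_
    have : s = ∅ := by
      by_contra hs'
      obtain ⟨a, ha⟩ := nonempty_iff_ne_empty.2 hs'
      exact hne a (measure_mono_null (singleton_subset_iff.2 ha) hs)
    simp [this]
  have hrn : ∀ a, μ.rnDeriv ν a ≤ ENNReal.ofReal C := by
    intro a
    have h1 := Measure.setLIntegral_rnDeriv hac {a}
    rw [lintegral_singleton] at h1
    calc μ.rnDeriv ν a = μ.rnDeriv ν a * 1 := (mul_one _).symm
      _ ≤ μ.rnDeriv ν a * (ENNReal.ofReal C * ν {a}) := by gcongr; exact hC a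
      _ = ENNReal.ofReal C * μ {a} := by rw [← h1]; ring
      _ ≤ ENNReal.ofReal C * 1 := by gcongr; exact prob_le_one
      _ = ENNReal.ofReal C := mul_one _
  have hint : Integrable (llr μ ν) μ := Integrable.of_finite
  rw [InformationTheory.klDiv_of_ac_of_integrable hac hint]
  refine ENNReal.ofReal_le_ofReal ?_
  simp only [probReal_univ, add_sub_cancel_right]
  calc ∫ x, llr μ ν x ∂μ ≤ ∫ _x, Real.log C ∂μ := by
        refine integral_mono_ae hint (integrable_const _) ?_
        filter_upwards [Measure.rnDeriv_pos hac, hac.ae_le (Measure.rnDeriv_lt_top μ ν)] with a h0 h1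
        refine Real.log_le_log (ENNReal.toReal_pos h0.ne' h1.ne) ?_
        refine ENNReal.toReal_le_of_le_ofReal ?_ (hrn a)
        by_contra h
        exact absurd (h0.trans_le (hrn a)) (by simp [ENNReal.ofReal_of_nonpos (not_le.1 h).le])
    _ = Real.log C := by simp

/-- With `m = min α (1 - α)`, each atom of the product measure has mass at least `m^N`, so no
density with respect to it exceeds `m^{-N}`. -/
theorem exists_isEntropyConstant {α : ℝ} (hα : α ∈ Ioo (0 : ℝ) 1) :
    ∃ K₀, IsEntropyConstant α K₀ := by
  set m := min α (1 - α) with hm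
  have hm0 : 0 < m := lt_min hα.1 (by linarith [hα.2])
  refine ⟨-Real.log m, fun N μ hμ => ?_⟩
  have := isProbabilityMeasure_bernoulliProduct hα N
  have h := klDiv_le_log_of_singleton μ (bernoulliProduct α N) (C := (m ^ (N : ℕ))⁻¹) ?_
  · rwa [Real.log_inv, Real.log_pow, ← mul_neg, mul_comm] at h
  · intro η
    rw [bernoulliProduct_singleton hα, ← ENNReal.ofReal_mul (by positivity), ← ENNReal.ofReal_one]
    refine ENNReal.ofReal_le_ofReal ?_
    rw [le_inv_mul_iff₀ (by positivity), mul_one]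
    calc m ^ (N : ℕ) = ∏ _x : ZMod N, m := by simp [ZMod.card]
      _ ≤ _ := by
        refine Finset.prod_le_prod (fun _ _ => hm0.le) fun x _ => ?_
        split_ifs
        · exact min_le_left _ _
        · exact min_le_right _ _

theorem klDiv_dirac {S : Type*} [Finite S] [MeasurableSpace S] [MeasurableSingletonClass S]
    (ν : Measure S) [IsProbabilityMeasure ν] {a : S} (ha : ν {a} ≠ 0) :
    InformationTheory.klDiv (Measure.dirac a) ν = ENNReal.ofReal (-Real.log (ν.real {a})) := by
  have hac : Measure.dirac a ≪ ν := by
    refine Measure.AbsolutelyContinuous.mk fun s hs hs0 => ?_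
    rw [Measure.dirac_apply' a hs, indicator_of_notMem]
    exact fun h => ha (measure_mono_null (singleton_subset_iff.2 h) hs0)
  have hint : Integrable (llr (Measure.dirac a) ν) (Measure.dirac a) := Integrable.of_finite
  rw [InformationTheory.klDiv_of_ac_of_integrable hac hint]
  simp only [probReal_univ, add_sub_cancel_right, integral_dirac]
  have h1 := Measure.setLIntegral_rnDeriv hac {a}
  rw [lintegral_singleton] at h1
  have h2 : (Measure.dirac a).rnDeriv ν a = (ν {a})⁻¹ := by
    refine ENNReal.eq_inv_of_mul_eq_one_left ?_
    simpa using h1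
  rw [llr, h2, ENNReal.toReal_inv, Real.log_inv, measureReal_def]

/-- Already `N = 1` suffices: the point masses at the occupied and the empty configuration have
entropies `-log α` and `-log (1 - α)`, and one of them is at least `log 2`. The dynamical estimate
produces exactly `log 2`, so this is the only property of entropy constants that the energy bound
needs. -/
theorem IsEntropyConstant.log_two_le {α : ℝ} (hα : α ∈ Ioo (0 : ℝ) 1) {K₀ : ℝ}
    (h : IsEntropyConstant α K₀) : Real.log 2 ≤ K₀ := by
  have := isProbabilityMeasure_bernoulliProduct hα 1
  -- The second alternative comes from the truncation of `ENNReal.ofReal` at zero; it is excluded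
  -- below because `log 2 > 0`.
  have key : ∀ c : Bool, -Real.log (if c then α else 1 - α) ≤ K₀ ∨
      -Real.log (if c then α else 1 - α) ≤ 0 := by
    intro c
    have h1 : bernoulliProduct α 1 {fun _ => c} = ENNReal.ofReal (if c then α else 1 - α) := by
      rw [bernoulliProduct_singleton hα]
      congr 1
      exact Fintype.prod_unique _
    have h0 : 0 < if c then α else 1 - α := by
      split_ifs
      · exact hα.1
      · linarith [hα.2]
    have h2 := h 1 (Measure.dirac fun _ => c) inferInstance
    have h3 := klDiv_dirac (bernoulliProduct α 1) (a := fun _ => c) (by rw [h1]; simpa using h0)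
    rw [measureReal_def, h1, ENNReal.toReal_ofReal h0.le] at h3
    have h4 := h3.symm.trans_le h2
    simpa [ENNReal.ofReal_le_ofReal_iff'] using h4
  have lower : ∀ x : ℝ, 0 < x → x ≤ 1 / 2 → Real.log 2 ≤ -Real.log x := by
    intro x hx hx2
    rw [← Real.log_inv]
    refine Real.log_le_log two_pos ?_
    rw [le_inv_comm₀ two_pos hx]
    linarith
  have hl2 := Real.log_pos one_lt_two
  rcases le_total α (1 / 2) with hle | hle
  · have := lower α hα.1 hle
    rcases key true with h5 | h5 <;> simp only [if_true] at h5 <;> linarith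
  · have := lower (1 - α) (by linarith [hα.2]) (by linarith)
    rcases key false with h5 | h5 <;> simp only [Bool.false_eq_true, if_false] at h5 <;> linarith

/-! ### Products of kernels on a finite set -/

/-- Summing out the first coordinate replaces the row vector `a` by `a K₀`, at the cost of a factor
`c` in squared norm. After all steps Cauchy-Schwarz turns the plain sum into an `ℓ²` norm, hence the
factor `card S`. -/
theorem sq_sum_path_prod_le {S : Type*} [Fintype S] {c : ℝ} (hc : 0 ≤ c) :
    ∀ (n : ℕ) (K : Fin n → S → S → ℝ),
      (∀ i (a : S → ℝ), ∑ y, (∑ x, a x * K i x y) ^ 2 ≤ c * ∑ x, a x ^ 2) →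
      ∀ a : S → ℝ, (∑ ζ : Fin (n + 1) → S, a (ζ 0) * ∏ i : Fin n, K i (ζ i.castSucc) (ζ i.succ)) ^ 2
        ≤ Fintype.card S * c ^ n * ∑ x, a x ^ 2 := by
  intro n
  induction n with
  | zero =>
    intro K _ a
    have h : (∑ ζ : Fin 1 → S, a (ζ 0)) = ∑ x, a x :=
      Fintype.sum_equiv (Equiv.funUnique (Fin 1) S) _ _ fun ζ => rfl
    simpa [h] using sq_sum_le_card_mul_sum_sq (s := Finset.univ) (f := a)
  | succ n ih =>
    intro K hK a
    have h : (∑ ζ : Fin (n + 1 + 1) → S,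
          a (ζ 0) * ∏ i : Fin (n + 1), K i (ζ i.castSucc) (ζ i.succ))
        = ∑ ζ : Fin (n + 1) → S, (∑ x, a x * K 0 x (ζ 0)) *
          ∏ i : Fin n, K i.succ (ζ i.castSucc) (ζ i.succ) := by
      rw [← (Fin.consEquiv fun _ : Fin (n + 1 + 1) => S).sum_comp, Fintype.sum_prod_type,
        Finset.sum_comm]
      refine Finset.sum_congr rfl fun ζ _ => ?_
      rw [Finset.sum_mul]
      refine Finset.sum_congr rfl fun x _ => ?_
      rw [Fin.prod_univ_succ]
      simp only [Fin.consEquiv_apply, Fin.cons_zero, Fin.cons_succ, Fin.castSucc_zero,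
        ← Fin.succ_castSucc]
      ring
    rw [h]
    calc _ ≤ Fintype.card S * c ^ n * ∑ y, (∑ x, a x * K 0 x y) ^ 2 :=
          ih (fun i => K i.succ) (fun i => hK i.succ) fun y => ∑ x, a x * K 0 x y
      _ ≤ Fintype.card S * c ^ n * (c * ∑ x, a x ^ 2) := by gcongr; exact hK 0 a
      _ = _ := by ring

/-- One step of a Feynman-Kac product: if `M = 1 + δ G + O(δ r)` and `G + w` is nonpositive as a
quadratic form, then `a ↦ (a M) e^{δ w}` has norm at most `1 + δ o(1)`. -/
theorem sum_sq_step_le {S : Type*} [Fintype S] [DecidableEq S] (G M : S → S → ℝ) (w a : S → ℝ)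
    {B g δ r κ : ℝ} (hB : 0 ≤ B) (hg : ∑ x, ∑ y, |G x y| ≤ g) (hδ : 0 < δ) (hδ1 : δ ≤ 1)
    (hδB : δ * B ≤ 1) (hr : 0 ≤ r) (hw : ∀ x, |w x| ≤ B)
    (hM : ∀ x y, |M x y - ((if x = y then 1 else 0) + δ * G x y)| ≤ δ * r)
    (hκ : δ * (B * g + B ^ 2 + B ^ 2 * g) + 3 * (Fintype.card S * r) ≤ κ) (hκ1 : κ ≤ 1)
    (hq : ∑ x, w x * a x ^ 2 + ∑ y, a y * ∑ x, a x * G x y ≤ 0) :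
    ∑ y, (∑ x, a x * (M x y * Real.exp (δ * w y))) ^ 2
      ≤ (1 + δ * (Fintype.card S * (δ * (B + g + 1) ^ 2 + 2 * κ))) * ∑ x, a x ^ 2 := by
  set A := √(∑ x, a x ^ 2) with hA
  have hA2 : A ^ 2 = ∑ x, a x ^ 2 := Real.sq_sqrt (Finset.sum_nonneg fun _ _ => sq_nonneg _)
  have hA0 : 0 ≤ A := Real.sqrt_nonneg _
  have haA : ∀ x, |a x| ≤ A := fun x => by
    rw [← Real.sqrt_sq_eq_abs]
    exact Real.sqrt_le_sqrt
      (Finset.single_le_sum (f := fun x => a x ^ 2) (fun _ _ => sq_nonneg _) (Finset.mem_univ x))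
  have hg0 : 0 ≤ g := (Finset.sum_nonneg fun _ _ => Finset.sum_nonneg fun _ _ => abs_nonneg _).trans hg
  set h : S → ℝ := fun y => ∑ x, a x * G x y with hh
  have hhA : ∀ y, |h y| ≤ g * A := by
    intro y
    calc |h y| ≤ ∑ x, |a x * G x y| := Finset.abs_sum_le_sum_abs _ _
      _ ≤ ∑ x, A * |G x y| := by
        refine Finset.sum_le_sum fun x _ => ?_
        rw [abs_mul]
        gcongr
        exact haA x
      _ ≤ ∑ x, A * ∑ y, |G x y| := by
        refine Finset.sum_le_sum fun x _ => ?_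
        gcongr
        exact Finset.single_le_sum (f := fun y => |G x y|) (fun _ _ => abs_nonneg _)
          (Finset.mem_univ y)
      _ ≤ g * A := by rw [← Finset.mul_sum, mul_comm]; gcongr
  have key : ∀ y, (∑ x, a x * (M x y * Real.exp (δ * w y))) ^ 2 ≤
      a y ^ 2 + 2 * δ * (w y * a y ^ 2 + a y * h y)
        + δ * (δ * (B + g + 1) ^ 2 + 2 * κ) * A ^ 2 := by
    intro y
    obtain ⟨m, hm⟩ : ∃ m, m = ∑ x, a x * M x y - (a y + δ * h y) := ⟨_, rfl⟩
    have hm1 : |m| ≤ δ * (Fintype.card S * r) * A := by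
      have : m = ∑ x, a x * (M x y - ((if x = y then 1 else 0) + δ * G x y)) := by
        simp only [hm, mul_sub, mul_add, Finset.sum_sub_distrib, Finset.sum_add_distrib, mul_ite,
          mul_one, mul_zero, Finset.sum_ite_eq', Finset.mem_univ, if_true, hh, Finset.mul_sum]
        congr 2
        exact Finset.sum_congr rfl fun x _ => by ring
      rw [this]
      calc _ ≤ ∑ x, |a x * (M x y - ((if x = y then 1 else 0) + δ * G x y))| :=
            Finset.abs_sum_le_sum_abs _ _
        _ ≤ ∑ _x : S, A * (δ * r) := by
          refine Finset.sum_le_sum fun x _ => ?_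
          rw [abs_mul]
          gcongr
          · exact haA x
          · exact hM x y
        _ = _ := by simp; ring
    have hdw : |δ * w y| ≤ δ * B := by
      rw [abs_mul, abs_of_pos hδ]
      gcongr
      exact hw y
    obtain ⟨e, he⟩ : ∃ e, e = Real.exp (δ * w y) - 1 - δ * w y := ⟨_, rfl⟩
    have he1 : |e| ≤ (δ * B) ^ 2 := by
      rw [he]
      refine (Real.abs_exp_sub_one_sub_id_le (hdw.trans hδB)).trans ?_
      rw [← sq_abs]
      gcongr
    have hE : |Real.exp (δ * w y)| ≤ 3 := by
      rw [abs_of_pos (Real.exp_pos _)]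
      refine (Real.exp_le_exp.2 (((le_abs_self _).trans hdw).trans hδB)).trans ?_
      exact Real.exp_one_lt_three.le
    -- Expansion of `(a + δh + m)(1 + δw + e)`, where `m` is the error of the kernel and `e` the
    -- second-order remainder of the exponential. `R` is everything beyond first order in `δ`, and
    -- `κ` is designed so that `|R| ≤ δκA`.
    obtain ⟨R, hR⟩ : ∃ R, R = δ ^ 2 * (w y * h y) + e * a y + δ * (e * h y)
        + Real.exp (δ * w y) * m := ⟨_, rfl⟩
    have hsum : ∑ x, a x * (M x y * Real.exp (δ * w y)) = a y + δ * (w y * a y + h y) + R := by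
      have h1 : ∑ x, a x * (M x y * Real.exp (δ * w y))
          = (∑ x, a x * M x y) * Real.exp (δ * w y) := by
        rw [Finset.sum_mul]
        exact Finset.sum_congr rfl fun x _ => by ring
      have h2 : ∑ x, a x * M x y = a y + δ * h y + m := by rw [hm]; ring
      rw [h1, hR, mul_comm (Real.exp _) m, h2]
      have h3 : Real.exp (δ * w y) = 1 + δ * w y + e := by rw [he]; ring
      rw [h3]
      ring
    have hR1 : |R| ≤ δ * κ * A := by
      have t1 : |δ ^ 2 * (w y * h y)| ≤ δ ^ 2 * (B * (g * A)) := by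
        rw [abs_mul, abs_of_pos (by positivity : 0 < δ ^ 2), abs_mul]
        gcongr
        · exact hw y
        · exact hhA y
      have t2 : |e * a y| ≤ (δ * B) ^ 2 * A := by
        rw [abs_mul]
        gcongr
        exact haA y
      have t3 : |δ * (e * h y)| ≤ δ * ((δ * B) ^ 2 * (g * A)) := by
        rw [abs_mul, abs_of_pos hδ, abs_mul]
        gcongr
        exact hhA y
      have t4 : |Real.exp (δ * w y) * m| ≤ 3 * (δ * (Fintype.card S * r) * A) := by
        rw [abs_mul]
        gcongr
      calc |R| ≤ δ ^ 2 * (B * (g * A)) + (δ * B) ^ 2 * A + δ * ((δ * B) ^ 2 * (g * A))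
            + 3 * (δ * (Fintype.card S * r) * A) := by
            rw [hR]
            refine (abs_add_le _ _).trans (add_le_add ?_ t4)
            refine (abs_add_le _ _).trans (add_le_add ?_ t3)
            exact (abs_add_le _ _).trans (add_le_add t1 t2)
        _ ≤ δ ^ 2 * (B * (g * A)) + (δ * B) ^ 2 * A + 1 * ((δ * B) ^ 2 * (g * A))
            + 3 * (δ * (Fintype.card S * r) * A) := by gcongr
        _ = δ * (δ * (B * g + B ^ 2 + B ^ 2 * g) + 3 * (Fintype.card S * r)) * A := by ring
        _ ≤ δ * κ * A := by gcongr
    have hκ0 : 0 ≤ κ := le_trans (by positivity) hκ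
    obtain ⟨q, hq'⟩ : ∃ q, q = w y * a y + h y := ⟨_, rfl⟩
    have hq1 : |q| ≤ (B + g) * A := by
      rw [hq', add_mul]
      refine (abs_add_le _ _).trans (add_le_add ?_ (hhA y))
      rw [abs_mul]
      gcongr
      · exact hw y
      · exact haA y
    rw [hsum, ← hq']
    have e1 : a y * R ≤ A * (δ * κ * A) :=
      (le_abs_self _).trans (by rw [abs_mul]; gcongr; exact haA y)
    have e2 : (δ * q + R) ^ 2 ≤ (δ * (B + g + 1) * A) ^ 2 := by
      rw [← sq_abs]
      gcongr
      calc |δ * q + R| ≤ |δ * q| + |R| := abs_add_le _ _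
        _ ≤ δ * ((B + g) * A) + δ * 1 * A := by
          rw [abs_mul, abs_of_pos hδ]
          refine add_le_add (by gcongr) (hR1.trans (by gcongr))
        _ = _ := by ring
    calc (a y + δ * q + R) ^ 2 = a y ^ 2 + 2 * δ * (a y * q) + 2 * (a y * R) + (δ * q + R) ^ 2 := by
          ring
      _ ≤ a y ^ 2 + 2 * δ * (a y * q) + 2 * (A * (δ * κ * A)) + (δ * (B + g + 1) * A) ^ 2 := by
          gcongr
      _ = _ := by rw [hq']; ring
  -- Summed over `y`, the first-order terms form `2δ` times the quadratic form in `hq` and can be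
  -- dropped.
  calc _ ≤ ∑ y, (a y ^ 2 + 2 * δ * (w y * a y ^ 2 + a y * h y)
        + δ * (δ * (B + g + 1) ^ 2 + 2 * κ) * A ^ 2) := Finset.sum_le_sum fun y _ => key y
    _ = A ^ 2 + 2 * δ * (∑ x, w x * a x ^ 2 + ∑ y, a y * h y)
        + δ * (Fintype.card S * (δ * (B + g + 1) ^ 2 + 2 * κ)) * A ^ 2 := by
      rw [Finset.sum_add_distrib, Finset.sum_add_distrib, ← Finset.mul_sum,
        Finset.sum_add_distrib, hA2]
      simp
      ring
    _ ≤ A ^ 2 + 2 * δ * 0 + δ * (Fintype.card S * (δ * (B + g + 1) ^ 2 + 2 * κ)) * A ^ 2 := by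
      gcongr
    _ = _ := by rw [hA2]; ring

/-! ### The exponential moment bound for the exclusion process -/

theorem conductance_nonneg {k : ℕ} {β : ℝ} {b : Fin k → ℝ} {N : ℕ} (x : ZMod N) :
    0 ≤ conductance β b x := by
  unfold conductance
  split_ifs <;> positivity

theorem measurable_eval {N : ℕ} (t : ℝ≥0) : Measurable fun ω : ConfigPath N => ω.1 t :=
  (measurable_pi_apply t).comp measurable_subtype_coe

section ExponentialMoment

variable {k : ℕ} {β : ℝ} {b : Fin k → ℝ} {N : ℕ} [NeZero N]

/-- The jump rates of the process speeded up by `N²`. -/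
def jumpRate (β : ℝ) (b : Fin k → ℝ) (N : ℕ) [NeZero N] (η ζ : Config N) : ℝ :=
  (N : ℝ) ^ 2 * generator β b N (Pi.single ζ 1) η

theorem jumpRate_nonneg {η ζ : Config N} (h : η ≠ ζ) : 0 ≤ jumpRate β b N η ζ := by
  refine mul_nonneg (by positivity) (Finset.sum_nonneg fun x _ => ?_)
  rw [Pi.single_eq_of_ne h, sub_zero]
  refine mul_nonneg (conductance_nonneg x) ?_
  rw [Pi.single_apply]
  split_ifs <;> simp

theorem sum_jumpRate_mul (a : Config N → ℝ) (η : Config N) :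
    ∑ ζ, jumpRate β b N η ζ * a ζ = (N : ℝ) ^ 2 * generator β b N a η := by
  have h : a = ∑ ζ, a ζ • (Pi.single ζ 1 : Config N → ℝ) := by
    funext η
    simp [Finset.sum_apply, Pi.single_apply]
  conv_rhs => rw [h, map_sum, Finset.sum_apply, Finset.mul_sum]
  refine Finset.sum_congr rfl fun ζ _ => ?_
  rw [map_smul, Pi.smul_apply, smul_eq_mul, jumpRate]
  ring

theorem transition_zero (η ζ : Config N) :
    transition β b N 0 η ζ = if η = ζ then 1 else 0 := by
  simp [transition, semigroup, Pi.single_apply]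

theorem hasDerivAt_transition (η ζ : Config N) :
    HasDerivAt (fun t => transition β b N t η ζ) (jumpRate β b N η ζ) 0 := by
  set A := LinearMap.toContinuousLinearMap (generator β b N) with hA
  have h1 := hasDerivAt_exp_smul_const (𝕂 := ℝ) ((N : ℝ) ^ 2 • A) (0 : ℝ)
  have h2 := (ContinuousLinearMap.apply ℝ (Config N → ℝ)
    (Pi.single ζ 1 : Config N → ℝ)).hasFDerivAt.comp_hasDerivAt (0 : ℝ) h1
  have h3 := (hasDerivAt_pi.1 h2) η
  have e : jumpRate β b N η ζ = (ContinuousLinearMap.apply ℝ (Config N → ℝ)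
      (Pi.single ζ 1 : Config N → ℝ)) (NormedSpace.exp ((0 : ℝ) • (N : ℝ) ^ 2 • A) *
        (N : ℝ) ^ 2 • A) η := by
    simp [jumpRate, hA]
  rw [e]
  refine h3.congr_of_eventuallyEq (Eventually.of_forall fun t => ?_)
  simp [transition, semigroup, hA, mul_smul]

/-- Finite-dimensional laws contain `ENNReal.ofReal` of the transition function, that is, its
positive part. The first-order expansion survives truncation because the approximation `1 + δ G` has
nonnegative entries for small `δ` and `max · 0` is 1-Lipschitz. Positivity of the semigroup is
therefore not needed. -/
theorem eventually_abs_max_transition_sub_le {r : ℝ} (hr : 0 < r) :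
    ∀ᶠ δ in 𝓝[>] (0 : ℝ), ∀ η ζ, |max (transition β b N δ η ζ) 0 -
      ((if η = ζ then 1 else 0) + δ * jumpRate β b N η ζ)| ≤ δ * r := by
  refine eventually_all.2 fun η => eventually_all.2 fun ζ => ?_
  have h1 := (hasDerivAt_iff_isLittleO_nhds_zero.1
    (hasDerivAt_transition (β := β) (b := b) η ζ)).bound hr
  have h2 : ∀ᶠ δ in 𝓝[>] (0 : ℝ),
      0 ≤ (if η = ζ then 1 else 0) + δ * jumpRate β b N η ζ := by
    by_cases h : η = ζ
    · have : Tendsto (fun δ : ℝ => 1 + δ * jumpRate β b N η ζ) (𝓝[>] 0)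
          (𝓝 (1 + 0 * jumpRate β b N η ζ)) :=
        (Continuous.tendsto (by fun_prop) 0).mono_left nhdsWithin_le_nhds
      filter_upwards [this.eventually (lt_mem_nhds (show (0 : ℝ) < _ by simp))] with δ hδ
      simpa [h] using hδ.le
    · filter_upwards [self_mem_nhdsWithin] with δ hδ
      simpa [h] using mul_nonneg (le_of_lt hδ) (jumpRate_nonneg (β := β) (b := b) h)
  filter_upwards [nhdsWithin_le_nhds h1, h2, self_mem_nhdsWithin] with δ h3 h4 h5
  rw [zero_add, transition_zero, Real.norm_eq_abs, Real.norm_eq_abs,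
    abs_of_pos (mem_Ioi.1 h5), smul_eq_mul, mul_comm r] at h3
  conv_lhs => rw [← max_eq_left h4]
  refine (abs_max_sub_max_le_abs _ _ _).trans ?_
  rwa [← sub_sub]

/-- The `j`-th point of the grid of mesh `T/n` in `[0,T]`. -/
def gridPoint {T : ℝ} (hT : 0 ≤ T) (n j : ℕ) : Icc (0 : ℝ) T := projIcc 0 T hT (j * (T / n))

theorem coe_gridPoint {T : ℝ} (hT : 0 ≤ T) {n j : ℕ} (h : j ≤ n) :
    (gridPoint hT n j : ℝ) = j * (T / n) := by
  rw [gridPoint, coe_projIcc, min_eq_right, max_eq_right (by positivity)]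
  rcases Nat.eq_zero_or_pos n with rfl | hn
  · simpa using hT
  · rw [mul_div_assoc', div_le_iff₀ (by positivity), mul_comm]
    gcongr

/-- A time in `[0,T]` as a nonnegative real number. -/
def toTime {T : ℝ} (t : Icc (0 : ℝ) T) : ℝ≥0 := ⟨t, t.2.1⟩

theorem card_config : (Fintype.card (Config N) : ℝ) = 2 ^ N := by
  simp [ZMod.card]

/-- The expectation is a sum over skeleton paths of a product of kernels. Each kernel has squared
`ℓ²` norm at most `c ≤ e^{δε}`, so the squared sum is at most `2^N · c^n · 2^N`: one factor `2^N`
from Cauchy-Schwarz, one from the initial vector `1`. -/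
theorem lintegral_exp_riemannSum_le {μ : Measure (Config N)} [IsProbabilityMeasure μ]
    {P : Measure (ConfigPath N)} (hP : IsExclusionLaw β b N μ P) {T : ℝ} (hT : 0 < T)
    (w : Icc (0 : ℝ) T → Config N → ℝ) {B : ℝ} (hB : ∀ t η, |w t η| ≤ B)
    (hw : ∀ t (a : Config N → ℝ),
      ∑ η, w t η * a η ^ 2 + (N : ℝ) ^ 2 * ∑ η, a η * generator β b N a η ≤ 0)
    {ε : ℝ} (hε : 0 < ε) :
    ∀ᶠ n : ℕ in atTop, ∫⁻ ω, ENNReal.ofReal (Real.exp (∑ i : Fin n,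
        T / n * w (gridPoint hT.le n (i + 1)) (ω.1 (toTime (gridPoint hT.le n (i + 1)))))) ∂P
      ≤ ENNReal.ofReal (2 ^ N * Real.exp (ε * T)) := by
  classical
  have hB0 : 0 ≤ B := (abs_nonneg _).trans (hB ⟨0, le_rfl, hT.le⟩ fun _ => true)
  set G := jumpRate β b N with hG
  set g := ∑ x, ∑ y, |G x y| with hg
  set C : ℝ := (Fintype.card (Config N) : ℝ) with hC
  have hC0 : 0 < C := by rw [hC, card_config]; positivity
  -- `r` makes the parts of `κ` and of the growth rate that do not vanish with `δ` smaller than `1`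
  -- and `ε`; the rest is small for fine grids.
  obtain ⟨r, hr0, hr1, hr2⟩ : ∃ r : ℝ, 0 < r ∧ 3 * (C * r) < 1 ∧ C * (2 * (3 * (C * r))) < ε := by
    refine ⟨min (1 / (6 * C)) (ε / (12 * C ^ 2)), by positivity, ?_, ?_⟩
    · calc 3 * (C * min (1 / (6 * C)) (ε / (12 * C ^ 2))) ≤ 3 * (C * (1 / (6 * C))) := by
            gcongr; exact min_le_left _ _
        _ = 1 / 2 := by field_simp; norm_num
        _ < 1 := by norm_num
    · calc C * (2 * (3 * (C * min (1 / (6 * C)) (ε / (12 * C ^ 2)))))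
          ≤ C * (2 * (3 * (C * (ε / (12 * C ^ 2))))) := by gcongr; exact min_le_right _ _
        _ = ε / 2 := by field_simp; norm_num
        _ < ε := by linarith
  set κ : ℝ → ℝ := fun δ => δ * (B * g + B ^ 2 + B ^ 2 * g) + 3 * (C * r) with hκ
  have ev1 : ∀ᶠ δ in 𝓝[>] (0 : ℝ), κ δ < 1 := by
    have : Tendsto κ (𝓝[>] 0) (𝓝 (κ 0)) :=
      (Continuous.tendsto (by fun_prop) 0).mono_left nhdsWithin_le_nhds
    exact this.eventually (gt_mem_nhds (by simpa [hκ] using hr1))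
  have ev2 : ∀ᶠ δ in 𝓝[>] (0 : ℝ), C * (δ * (B + g + 1) ^ 2 + 2 * κ δ) < ε := by
    have : Tendsto (fun δ => C * (δ * (B + g + 1) ^ 2 + 2 * κ δ)) (𝓝[>] 0)
        (𝓝 (C * (0 * (B + g + 1) ^ 2 + 2 * κ 0))) :=
      (Continuous.tendsto (f := fun δ => C * (δ * (B + g + 1) ^ 2 + 2 * κ δ))
        (by fun_prop) 0).mono_left nhdsWithin_le_nhds
    exact this.eventually (gt_mem_nhds (by simpa [hκ] using hr2))
  have ev3 : ∀ᶠ δ in 𝓝[>] (0 : ℝ), δ * B < 1 := by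
    have : Tendsto (fun δ : ℝ => δ * B) (𝓝[>] 0) (𝓝 (0 * B)) :=
      (Continuous.tendsto (by fun_prop) 0).mono_left nhdsWithin_le_nhds
    exact this.eventually (gt_mem_nhds (by simp))
  have ev4 : ∀ᶠ δ in 𝓝[>] (0 : ℝ), δ < 1 := nhdsWithin_le_nhds (gt_mem_nhds one_pos)
  have hlim : Tendsto (fun n : ℕ => T / (n : ℝ)) atTop (𝓝[>] 0) := by
    refine tendsto_nhdsWithin_iff.2 ⟨tendsto_const_div_atTop_nhds_zero_nat T, ?_⟩
    filter_upwards [eventually_gt_atTop 0] with n hn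
    exact div_pos hT (by exact_mod_cast hn)
  filter_upwards [hlim.eventually ev1, hlim.eventually ev2, hlim.eventually ev3,
    hlim.eventually ev4, eventually_gt_atTop 0,
    hlim.eventually (eventually_abs_max_transition_sub_le (β := β) (b := b) (N := N) hr0)]
    with n h1 h2 h3 h4 hn h5
  have hn' : (0 : ℝ) < n := by exact_mod_cast hn
  set δ : ℝ := T / n with hδ
  have hδ0 : 0 < δ := div_pos hT hn'
  set s : Fin (n + 1) → ℝ≥0 := fun i => toTime (gridPoint hT.le n i) with hs
  have hsc : ∀ i : Fin (n + 1), (s i : ℝ) = i * δ := fun i =>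
    coe_gridPoint hT.le (Nat.lt_succ_iff.1 i.2)
  set v : Fin n → Config N → ℝ := fun i => w (gridPoint hT.le n (i + 1)) with hv
  set K : Fin n → Config N → Config N → ℝ := fun i η ζ =>
    max (transition β b N δ η ζ) 0 * Real.exp (δ * v i ζ) with hK
  have hK0 : ∀ i η ζ, 0 ≤ K i η ζ := fun i η ζ => by positivity
  set c : ℝ := 1 + δ * (C * (δ * (B + g + 1) ^ 2 + 2 * κ δ)) with hc
  have hcε : c ≤ Real.exp (δ * ε) := by
    refine le_trans ?_ (Real.add_one_le_exp _)
    rw [hc, add_comm]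
    gcongr
  have hg0 : 0 ≤ g := Finset.sum_nonneg fun _ _ => Finset.sum_nonneg fun _ _ => abs_nonneg _
  have hκ0 : 0 ≤ κ δ := by positivity
  have hc0 : 0 ≤ c := by positivity
  have hstep : ∀ i (a : Config N → ℝ), ∑ y, (∑ x, a x * K i x y) ^ 2 ≤ c * ∑ x, a x ^ 2 := by
    intro i a
    refine sum_sq_step_le G (fun η ζ => max (transition β b N δ η ζ) 0) (v i) a hB0 le_rfl hδ0
      h4.le h3.le hr0.le (fun x => hB _ _) h5 le_rfl h1.le ?_
    refine le_trans (le_of_eq ?_) (hw (gridPoint hT.le n (i + 1)) a)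
    congr 1
    simp only [Finset.mul_sum]
    rw [Finset.sum_comm]
    refine Finset.sum_congr rfl fun x _ => ?_
    rw [mul_left_comm, ← sum_jumpRate_mul, Finset.mul_sum]
    exact Finset.sum_congr rfl fun y _ => by rw [hG]; ring
  have htot := sq_sum_path_prod_le hc0 n K hstep fun _ => 1
  have htot2 : ∑ ζ : Fin (n + 1) → Config N, ∏ i : Fin n, K i (ζ i.castSucc) (ζ i.succ)
      ≤ 2 ^ N * Real.exp (ε * T) := by
    refine abs_le_of_sq_le_sq' ?_ (by positivity) |>.2
    simp only [one_mul, one_pow, Finset.sum_const, Finset.card_univ, nsmul_eq_mul, mul_one] at htot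
    refine htot.trans ?_
    rw [card_config, mul_pow]
    calc (2 : ℝ) ^ N * c ^ n * 2 ^ N = (2 ^ N) ^ 2 * c ^ n := by ring
      _ ≤ (2 ^ N) ^ 2 * Real.exp (δ * ε) ^ n := by gcongr
      _ = (2 ^ N) ^ 2 * Real.exp (ε * T) := by
        rw [← Real.exp_nat_mul, hδ]
        congr 2
        field_simp
      _ ≤ (2 ^ N) ^ 2 * Real.exp (ε * T) ^ 2 := by
        gcongr
        exact le_self_pow₀ (Real.one_le_exp (by positivity)) two_ne_zero
  set Z : ConfigPath N → Fin (n + 1) → Config N := fun ω i => ω.1 (s i) with hZ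
  have hZm : Measurable Z := measurable_pi_lambda _ fun i => measurable_eval _
  set f : (Fin (n + 1) → Config N) → ℝ≥0∞ := fun ζ =>
    ENNReal.ofReal (Real.exp (∑ i : Fin n, δ * v i (ζ i.succ))) with hf
  have hmono : Monotone s := by
    intro i j hij
    rw [← NNReal.coe_le_coe, hsc, hsc]
    gcongr
    exact_mod_cast hij
  have hs0 : s 0 = 0 := by
    rw [← NNReal.coe_eq_zero, hsc]
    simp
  calc _ = ∫⁻ ω, f (Z ω) ∂P := by
        refine lintegral_congr fun ω => ?_
        simp only [hf, hZ, hs, Fin.val_succ, hv]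
    _ = ∑ ζ, f ζ * P {ω | ∀ i, ω.1 (s i) = ζ i} := by
        rw [← lintegral_map (f := f) (measurable_of_finite f) hZm, lintegral_fintype]
        refine Finset.sum_congr rfl fun ζ _ => ?_
        rw [Measure.map_apply hZm (measurableSet_singleton ζ)]
        congr 2
        ext ω
        simp [hZ, funext_iff]
    _ ≤ ∑ ζ : Fin (n + 1) → Config N,
          ENNReal.ofReal (∏ i : Fin n, K i (ζ i.castSucc) (ζ i.succ)) := by
        refine Finset.sum_le_sum fun ζ _ => ?_
        rw [hP.finite_dim n s ζ hmono hs0]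
        have hdiff : ∀ i : Fin n, (s i.succ : ℝ) - s i.castSucc = δ := fun i => by
          rw [hsc, hsc]
          simp
          ring
        simp only [hdiff]
        -- The initial law enters only here: its weights are at most `1`, so counting measure may
        -- replace it.
        calc f ζ * (μ {ζ 0} * ∏ i : Fin n,
              ENNReal.ofReal (transition β b N δ (ζ i.castSucc) (ζ i.succ)))
            ≤ f ζ * (1 * ∏ i : Fin n,
              ENNReal.ofReal (transition β b N δ (ζ i.castSucc) (ζ i.succ))) := by
              gcongr
              exact prob_le_one
          _ = _ := by
            simp only [one_mul, hf, hK]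
            rw [Real.exp_sum, ENNReal.ofReal_prod_of_nonneg fun _ _ => by positivity,
              ENNReal.ofReal_prod_of_nonneg fun _ _ => hK0 _ _ _, ← Finset.prod_mul_distrib]
            refine Finset.prod_congr rfl fun i _ => ?_
            rw [mul_comm, ENNReal.ofReal_mul (le_max_right _ _), ENNReal.ofReal_max]
            simp
    _ = ENNReal.ofReal (∑ ζ : Fin (n + 1) → Config N,
          ∏ i : Fin n, K i (ζ i.castSucc) (ζ i.succ)) := by
        rw [ENNReal.ofReal_sum_of_nonneg fun _ _ => Finset.prod_nonneg fun _ _ => hK0 _ _ _]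
    _ ≤ _ := ENNReal.ofReal_le_ofReal htot2

end ExponentialMoment

/-! ### The Dirichlet form -/

theorem exchange_involutive {N : ℕ} (x : ZMod N) : Function.Involutive (exchange x) := by
  intro η
  funext y
  simp [exchange]

theorem occ_exchange_left {N : ℕ} (x : ZMod N) (η : Config N) :
    occ (exchange x η) x = occ η (x + 1) := by
  simp [occ, exchange]

theorem occ_exchange_right {N : ℕ} (x : ZMod N) (η : Config N) :
    occ (exchange x η) (x + 1) = occ η x := by
  simp [occ, exchange]

theorem occ_mem_Icc {N : ℕ} (η : Config N) (x : ZMod N) : occ η x ∈ Icc (0 : ℝ) 1 := by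
  unfold occ
  split_ifs <;> simp

theorem sum_comp_exchange {N : ℕ} [NeZero N] (x : ZMod N) (f : Config N → ℝ) :
    ∑ η, f (exchange x η) = ∑ η, f η :=
  Equiv.sum_comp (exchange_involutive x).toPerm f

/-- Reversibility: `exchange x` is an involution, hence preserves counting measure, and polarization
gives minus half the squared gradient. -/
theorem sum_mul_sub_exchange {N : ℕ} [NeZero N] (x : ZMod N) (a : Config N → ℝ) :
    ∑ η, a η * (a (exchange x η) - a η) = -(1 / 2) * ∑ η, (a (exchange x η) - a η) ^ 2 := by
  have h := sum_comp_exchange x fun η => a η ^ 2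
  have h2 : ∑ η, (a (exchange x η) - a η) ^ 2
      = ∑ η, a (exchange x η) ^ 2 - ∑ η, a η ^ 2 - 2 * ∑ η, a η * (a (exchange x η) - a η) := by
    rw [Finset.mul_sum, ← Finset.sum_sub_distrib, ← Finset.sum_sub_distrib]
    exact Finset.sum_congr rfl fun η _ => by ring
  rw [h2, h]
  ring

theorem sum_mul_generator {k : ℕ} (β : ℝ) (b : Fin k → ℝ) {N : ℕ} [NeZero N]
    (a : Config N → ℝ) :
    ∑ η, a η * generator β b N a η =
      -(1 / 2) * ∑ x, conductance β b x * ∑ η, (a (exchange x η) - a η) ^ 2 := by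
  have : ∀ x, conductance β b x * ∑ η, a η * (a (exchange x η) - a η)
      = -(1 / 2) * (conductance β b x * ∑ η, (a (exchange x η) - a η) ^ 2) := fun x => by
    rw [sum_mul_sub_exchange]
    ring
  rw [Finset.mul_sum, ← Finset.sum_congr rfl fun x _ => this x]
  simp only [generator, LinearMap.coe_mk, AddHom.coe_mk, Finset.mul_sum]
  rw [Finset.sum_comm]
  exact Finset.sum_congr rfl fun x _ => Finset.sum_congr rfl fun η _ => by ring

/-- The exchange flips the sign of `occ η x - occ η (x + 1)`, so symmetrizing turns `a²` into `½(a²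
- a'²) = ½(a - a')(a + a')`. Young's inequality sends `a - a'` into the Dirichlet form, and `(a +
a')² ≤ 2(a² + a'²)` handles the rest. -/
theorem sum_occ_sub_mul_sq_le {N : ℕ} [NeZero N] (x : ZMod N) (c : ℝ) (a : Config N → ℝ) :
    N * c * ∑ η, (occ η x - occ η (x + 1)) * a η ^ 2 ≤
      (N : ℝ) ^ 2 * (1 / 2) * ∑ η, (a (exchange x η) - a η) ^ 2 + 1 / 2 * c ^ 2 * ∑ η, a η ^ 2 := by
  have h1 := sum_comp_exchange x fun η => (occ η x - occ η (x + 1)) * a η ^ 2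
  simp only [occ_exchange_left, occ_exchange_right] at h1
  have h2 : ∑ η, (occ η x - occ η (x + 1)) * a η ^ 2
      = ∑ η, 1 / 2 * ((occ η x - occ η (x + 1)) * (a η ^ 2 - a (exchange x η) ^ 2)) := by
    have : ∑ η, (occ η x - occ η (x + 1)) * a η ^ 2 = 1 / 2 *
        (∑ η, (occ η x - occ η (x + 1)) * a η ^ 2
          + ∑ η, (occ η (x + 1) - occ η x) * a (exchange x η) ^ 2) := by
      rw [h1]
      ring
    rw [this, ← Finset.sum_add_distrib, Finset.mul_sum]
    exact Finset.sum_congr rfl fun η _ => by ring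
  have h3 : ∑ η, a η ^ 2 = ∑ η, 1 / 2 * (a η ^ 2 + a (exchange x η) ^ 2) := by
    rw [← Finset.mul_sum, Finset.sum_add_distrib, sum_comp_exchange x fun η => a η ^ 2]
    ring
  rw [h2, h3, Finset.mul_sum, Finset.mul_sum, Finset.mul_sum, ← Finset.sum_add_distrib]
  refine Finset.sum_le_sum fun η _ => ?_
  obtain ⟨d, hd⟩ : ∃ d, d = occ η x - occ η (x + 1) := ⟨_, rfl⟩
  have hd1 : d ^ 2 ≤ 1 := by
    have h4 := occ_mem_Icc η x
    have h5 := occ_mem_Icc η (x + 1)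
    rw [sq_le_one_iff_abs_le_one, abs_le]
    constructor <;> linarith [h4.1, h4.2, h5.1, h5.2]
  rw [← hd]
  generalize a (exchange x η) = a'
  generalize a η = a₀
  have e1 : 0 ≤ (N * (a₀ - a') - 1 / 2 * c * d * (a₀ + a')) ^ 2 := sq_nonneg _
  have e2 : d ^ 2 * (c * (a₀ + a')) ^ 2 ≤ 1 * (c * (a₀ + a')) ^ 2 := by gcongr
  have e3 : 0 ≤ (c * (a₀ - a')) ^ 2 := sq_nonneg _
  nlinarith [e1, e2, e3]

/-- The variational estimate behind the energy bound: the linear functional of the configuration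
given by the discrete derivative of `h` is dominated by the Dirichlet form. -/
theorem discreteDerivative_add_dirichlet_nonpos {k : ℕ} (β : ℝ) (b : Fin k → ℝ) {N : ℕ} [NeZero N]
    (h : ZMod N → ℝ) (hh : ∀ x, IsSlow b x → h (x + 1) = 0) (a : Config N → ℝ) :
    ∑ η, (∑ x, N * (h (x + 1) - h x) * occ η x - 1 / 2 * ∑ x, h x ^ 2) * a η ^ 2
      + (N : ℝ) ^ 2 * ∑ η, a η * generator β b N a η ≤ 0 := by
  have e1 : ∀ η : Config N, ∑ x, N * (h (x + 1) - h x) * occ η x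
      = ∑ x, N * h (x + 1) * (occ η x - occ η (x + 1)) := by
    intro η
    have := Equiv.sum_comp (Equiv.addRight (1 : ZMod N)) fun x => N * h x * occ η x
    simp only [Equiv.coe_addRight] at this
    simp only [mul_sub, sub_mul, Finset.sum_sub_distrib, this]
  have e2 : ∑ x, h x ^ 2 = ∑ x, h (x + 1) ^ 2 :=
    (Equiv.sum_comp (Equiv.addRight (1 : ZMod N)) fun x => h x ^ 2).symm
  rw [sum_mul_generator]
  simp only [e1, e2, sub_mul, Finset.sum_sub_distrib, Finset.sum_mul]
  rw [Finset.sum_comm]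
  have key : ∀ x, ∑ η, N * h (x + 1) * (occ η x - occ η (x + 1)) * a η ^ 2 ≤
      (N : ℝ) ^ 2 * (1 / 2) * (conductance β b x * ∑ η, (a (exchange x η) - a η) ^ 2)
        + 1 / 2 * h (x + 1) ^ 2 * ∑ η, a η ^ 2 := by
    intro x
    have h0 : 0 ≤ ∑ η, (a (exchange x η) - a η) ^ 2 := Finset.sum_nonneg fun _ _ => sq_nonneg _
    -- A slow bond has too small a conductance to absorb anything, but there the coefficient `h (x +
    -- 1)` is zero and nonnegativity of the Dirichlet term is enough.
    by_cases hs : IsSlow b x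
    · have := conductance_nonneg (β := β) (b := b) x
      rw [hh x hs]
      simp only [mul_zero, zero_mul, Finset.sum_const_zero]
      positivity
    · have := sum_occ_sub_mul_sq_le x (h (x + 1)) a
      simpa only [Finset.mul_sum, conductance, hs, if_false, one_mul, mul_assoc] using this
  have := Finset.sum_le_sum fun x (_ : x ∈ Finset.univ) => key x
  rw [Finset.sum_add_distrib, ← Finset.mul_sum, ← Finset.sum_mul, ← Finset.mul_sum] at this
  rw [← Finset.mul_sum]
  linarith

/-! ### Riemann sums in time -/

instance (T : ℝ) : IsFiniteMeasure (timeMeasure T) := by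
  refine ⟨?_⟩
  rw [timeMeasure, (MeasurableEmbedding.subtype_coe measurableSet_Icc).comap_apply]
  refine (measure_mono (t := Icc 0 T) ?_).trans_lt (by simp)
  rintro _ ⟨x, _, rfl⟩
  exact x.2

theorem timeMeasure_univ (T : ℝ) : timeMeasure T univ = ENNReal.ofReal T := by
  rw [timeMeasure, (MeasurableEmbedding.subtype_coe measurableSet_Icc).comap_apply, image_univ,
    Subtype.range_coe, Real.volume_Icc, sub_zero]

theorem integral_timeMeasure {T : ℝ} (f : ℝ → ℝ) :
    ∫ t, f t ∂timeMeasure T = ∫ t in Icc 0 T, f t :=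
  integral_subtype_comap measurableSet_Icc f

/-- The first point of the grid of mesh `T/n` that does not precede `t`. -/
def gridCeil {T : ℝ} (hT : 0 ≤ T) (n : ℕ) (t : Icc (0 : ℝ) T) : Icc (0 : ℝ) T :=
  gridPoint hT n ⌈(t : ℝ) * (n / T)⌉₊

/-- The grid approximation comes from the right, so that right-continuity of paths suffices for
convergence of Riemann sums. -/
theorem tendsto_gridCeil {T : ℝ} (hT : 0 < T) (t : Icc (0 : ℝ) T) :
    Tendsto (fun n => gridCeil hT.le n t) atTop (𝓝[≥] t) := by
  have hle : ∀ n : ℕ, 0 < n → ⌈(t : ℝ) * (n / T)⌉₊ ≤ n := fun n hn => by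
    rw [Nat.ceil_le, mul_div_assoc', div_le_iff₀ hT, mul_comm]
    exact mul_le_mul_of_nonneg_left t.2.2 (by positivity)
  have hlow : ∀ n : ℕ, 0 < n → (t : ℝ) ≤ gridCeil hT.le n t := fun n hn => by
    rw [gridCeil, coe_gridPoint hT.le (hle n hn)]
    have hn' : (0 : ℝ) < n := by exact_mod_cast hn
    calc (t : ℝ) = t * (n / T) * (T / n) := by field_simp
      _ ≤ _ := by gcongr; exact Nat.le_ceil _
  have hup : ∀ n : ℕ, 0 < n → (gridCeil hT.le n t : ℝ) ≤ t + T / n := fun n hn => by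
    rw [gridCeil, coe_gridPoint hT.le (hle n hn)]
    have hn' : (0 : ℝ) < n := by exact_mod_cast hn
    calc (⌈(t : ℝ) * (n / T)⌉₊ : ℝ) * (T / n) ≤ (t * (n / T) + 1) * (T / n) := by
          gcongr
          exact (Nat.ceil_lt_add_one (mul_nonneg t.2.1 (by positivity))).le
      _ = t + T / n := by field_simp
  refine tendsto_nhdsWithin_iff.2 ⟨tendsto_subtype_rng.2 ?_, ?_⟩
  · have h1 : Tendsto (fun n : ℕ => (t : ℝ) + T / n) atTop (𝓝 (t + 0)) :=
      tendsto_const_nhds.add (tendsto_const_div_atTop_nhds_zero_nat T)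
    rw [add_zero] at h1
    refine tendsto_of_tendsto_of_tendsto_of_le_of_le' tendsto_const_nhds h1 ?_ ?_
    · filter_upwards [eventually_gt_atTop 0] with n hn using hlow n hn
    · filter_upwards [eventually_gt_atTop 0] with n hn using hup n hn
  · filter_upwards [eventually_gt_atTop 0] with n hn using hlow n hn

/-- The composition factors through `ℕ`, so `f` may be arbitrary; measurability of right-continuous
functions then follows by taking limits. -/
theorem measurable_comp_gridCeil {T : ℝ} (hT : 0 ≤ T) (n : ℕ) {E : Type*} [MeasurableSpace E]
    (f : Icc (0 : ℝ) T → E) : Measurable fun t => f (gridCeil hT n t) :=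
  (measurable_from_nat (f := fun j => f (gridPoint hT n j))).comp
    (Nat.measurable_ceil.comp (measurable_subtype_coe.mul_const _))

theorem measurable_of_rightContinuous {T : ℝ} (hT : 0 < T) {f : Icc (0 : ℝ) T → ℝ}
    (hf : ∀ t, ContinuousWithinAt f (Ici t) t) : Measurable f :=
  measurable_of_tendsto_metrizable (fun n => measurable_comp_gridCeil hT.le n f)
    (tendsto_pi_nhds.2 fun t => (hf t).tendsto.comp (tendsto_gridCeil hT t))

theorem integral_comp_gridCeil {T : ℝ} (hT : 0 < T) {n : ℕ} (hn : 0 < n)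
    (f : Icc (0 : ℝ) T → ℝ) :
    ∫ t, f (gridCeil hT.le n t) ∂timeMeasure T
      = ∑ i : Fin n, T / n * f (gridPoint hT.le n (i + 1)) := by
  have hn' : (0 : ℝ) < n := by exact_mod_cast hn
  set F : ℝ → ℝ := fun t => f (gridPoint hT.le n ⌈t * (n / T)⌉₊) with hF
  have hconst : ∀ i : ℕ, EqOn (fun _ => f (gridPoint hT.le n (i + 1))) F
      (uIoc ((i : ℝ) * (T / n)) (((i + 1 : ℕ) : ℝ) * (T / n))) := by
    intro i t ht
    rw [uIoc_of_le (by gcongr; simp)] at ht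
    have : ⌈t * (n / T)⌉₊ = i + 1 := by
      rw [Nat.ceil_eq_iff (by simp)]
      have e : t * (n / T) = t / (T / n) := by field_simp
      rw [e, lt_div_iff₀ (by positivity), div_le_iff₀ (by positivity)]
      exact ⟨by simpa using ht.1, ht.2⟩
    simp [hF, this]
  have h1 : ∫ t, f (gridCeil hT.le n t) ∂timeMeasure T = ∫ t in (0 : ℝ)..T, F t := by
    rw [intervalIntegral.integral_of_le hT.le, ← integral_Icc_eq_integral_Ioc,
      ← integral_timeMeasure]
    rfl
  have h2 := intervalIntegral.sum_integral_adjacent_intervals (f := F) (μ := volume)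
    (a := fun i : ℕ => (i : ℝ) * (T / n)) (n := n) fun i _ =>
      (intervalIntegrable_congr (hconst i)).1 intervalIntegrable_const
  have h3 : (n : ℝ) * (T / n) = T := by field_simp
  simp only [Nat.cast_zero, zero_mul, h3] at h2
  rw [h1, ← h2, Finset.sum_range]
  refine Finset.sum_congr rfl fun i _ => ?_
  rw [← intervalIntegral.integral_congr_ae (Eventually.of_forall fun x hx => hconst i hx),
    intervalIntegral.integral_const, smul_eq_mul]
  push_cast
  ring

/-- Riemann sums at right end points converge along each càdlàg path, Fatou's lemma transfers the
discrete bound, and `ε → 0` removes the last factor. -/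
theorem lintegral_exp_integral_le {k : ℕ} {β : ℝ} {b : Fin k → ℝ} {N : ℕ} [NeZero N]
    {μ : Measure (Config N)} [IsProbabilityMeasure μ]
    {P : Measure (ConfigPath N)} (hP : IsExclusionLaw β b N μ P) {T : ℝ} (hT : 0 < T)
    (w : Icc (0 : ℝ) T → Config N → ℝ) (hc : ∀ η, Continuous fun t => w t η)
    (hw : ∀ t (a : Config N → ℝ),
      ∑ η, w t η * a η ^ 2 + (N : ℝ) ^ 2 * ∑ η, a η * generator β b N a η ≤ 0) :
    ∫⁻ ω, ENNReal.ofReal (Real.exp (∫ t, w t (ω.1 (toTime t)) ∂timeMeasure T)) ∂P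
      ≤ ENNReal.ofReal (2 ^ N) := by
  obtain ⟨B, hB⟩ : ∃ B, ∀ t η, |w t η| ≤ B := by
    have : ∀ η, ∃ C, ∀ t, |w t η| ≤ C := fun η => by
      obtain ⟨C, hC⟩ := (isCompact_range (hc η).abs).bddAbove
      exact ⟨C, fun t => hC ⟨t, rfl⟩⟩
    choose C hC using this
    exact ⟨∑ η, |C η|, fun t η => (hC η t).trans ((le_abs_self _).trans
      (Finset.single_le_sum (f := fun η => |C η|) (fun _ _ => abs_nonneg _) (Finset.mem_univ η)))⟩
  set F : ℕ → ConfigPath N → ℝ := fun n ω => ∑ i : Fin n,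
    T / n * w (gridPoint hT.le n (i + 1)) (ω.1 (toTime (gridPoint hT.le n (i + 1)))) with hF
  have hFm : ∀ n, Measurable (F n) := fun n => by
    refine Finset.measurable_sum _ fun i _ => Measurable.const_mul ?_ _
    exact (measurable_of_finite _).comp (measurable_eval _)
  have hlim : ∀ ω, Tendsto (fun n => F n ω) atTop
      (𝓝 (∫ t, w t (ω.1 (toTime t)) ∂timeMeasure T)) := by
    intro ω
    have h1 : ∀ᶠ n in atTop, ∫ t, w (gridCeil hT.le n t) (ω.1 (toTime (gridCeil hT.le n t)))
        ∂timeMeasure T = F n ω := by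
      filter_upwards [eventually_gt_atTop 0] with n hn
      exact integral_comp_gridCeil hT hn fun t => w t (ω.1 (toTime t))
    refine Tendsto.congr' h1 ?_
    refine tendsto_integral_of_dominated_convergence (fun _ => B)
      (fun n => (measurable_comp_gridCeil hT.le n
        fun t => w t (ω.1 (toTime t))).aestronglyMeasurable)
      (integrable_const _) (fun n => Eventually.of_forall fun t => hB _ _)
      (Eventually.of_forall fun t => ?_)
    have h2 := tendsto_gridCeil hT t
    have h3 : Tendsto (fun n => toTime (gridCeil hT.le n t)) atTop (𝓝[≥] (toTime t)) := by
      have h4 : Continuous (toTime (T := T)) := Continuous.subtype_mk continuous_subtype_val _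
      refine Tendsto.comp (tendsto_nhdsWithin_of_tendsto_nhds_of_eventually_within _
        (h4.continuousWithinAt (s := Ici t)).tendsto ?_) h2
      exact eventually_mem_nhdsWithin.mono fun s hs => hs
    have h5 : Tendsto (fun n => ω.1 (toTime (gridCeil hT.le n t))) atTop (𝓝 (ω.1 (toTime t))) :=
      (ω.2 (toTime t)).1.tendsto.comp h3
    -- The configuration space is discrete: a right-continuous path is constant just after `t`, so
    -- only continuity of `w` in time remains.
    rw [nhds_discrete, tendsto_pure] at h5
    have h6 : Tendsto (fun n => w (gridCeil hT.le n t) (ω.1 (toTime t))) atTop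
        (𝓝 (w t (ω.1 (toTime t)))) :=
      ((hc _).tendsto t).comp (h2.mono_right nhdsWithin_le_nhds)
    exact h6.congr' (h5.mono fun n hn => by simp only [hn])
  have hε : ∀ ε > 0, ∫⁻ ω, ENNReal.ofReal
      (Real.exp (∫ t, w t (ω.1 (toTime t)) ∂timeMeasure T)) ∂P
      ≤ ENNReal.ofReal (2 ^ N * Real.exp (ε * T)) := by
    intro ε hε
    have hev := lintegral_exp_riemannSum_le hP hT w hB hw hε
    calc _ = ∫⁻ ω, liminf (fun n => ENNReal.ofReal (Real.exp (F n ω))) atTop ∂P := by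
          refine lintegral_congr fun ω => ?_
          exact (((ENNReal.continuous_ofReal.comp Real.continuous_exp).tendsto _).comp
            (hlim ω)).liminf_eq.symm
      _ ≤ liminf (fun n => ∫⁻ ω, ENNReal.ofReal (Real.exp (F n ω)) ∂P) atTop :=
          lintegral_liminf_le fun n => (hFm n).exp.ennreal_ofReal
      _ ≤ _ := liminf_le_of_frequently_le' hev.frequently
  have hlim0 : Tendsto (fun ε : ℝ => ENNReal.ofReal (2 ^ N * Real.exp (ε * T))) (𝓝[>] 0)
      (𝓝 (ENNReal.ofReal (2 ^ N * Real.exp (0 * T)))) :=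
    (Continuous.tendsto (f := fun ε : ℝ => ENNReal.ofReal (2 ^ N * Real.exp (ε * T)))
      (ENNReal.continuous_ofReal.comp (by fun_prop)) 0).mono_left nhdsWithin_le_nhds
  rw [zero_mul, Real.exp_zero, mul_one] at hlim0
  exact ge_of_tendsto hlim0 (eventually_mem_nhdsWithin.mono hε)

/-! ### The space of sub-probability measures -/

theorem SubProb.measure_univ_le (ν : SubProb) : ν.toMeasure univ ≤ 1 := by
  have h : ν.1.mass ≤ 1 := ν.2
  have h2 : ((ν.1.mass : ℝ≥0) : ℝ≥0∞) ≤ 1 := by exact_mod_cast h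
  rwa [FiniteMeasure.ennreal_mass] at h2

instance (ν : SubProb) : IsFiniteMeasure ν.toMeasure :=
  ⟨ν.measure_univ_le.trans_lt ENNReal.one_lt_top⟩

theorem SubProb.integrable (ν : SubProb) (f : C(UnitAddCircle, ℝ)) :
    Integrable f ν.toMeasure :=
  (BoundedContinuousFunction.mkOfCompact f).integrable _

theorem SubProb.abs_pairing_le (ν : SubProb) (f : C(UnitAddCircle, ℝ)) : |ν.pairing f| ≤ ‖f‖ := by
  calc |ν.pairing f| ≤ ‖f‖ * ν.toMeasure.real univ :=
        norm_integral_le_of_norm_le_const (Eventually.of_forall fun u => f.norm_coe_le_norm u)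
    _ ≤ ‖f‖ * 1 := by
        gcongr
        exact ENNReal.toReal_le_of_le_ofReal zero_le_one (by simpa using ν.measure_univ_le)
    _ = ‖f‖ := mul_one _

theorem SubProb.abs_pairing_sub_le (ν : SubProb) (f g : C(UnitAddCircle, ℝ)) :
    |ν.pairing f - ν.pairing g| ≤ ‖f - g‖ := by
  have : ν.pairing f - ν.pairing g = ν.pairing (f - g) :=
    (integral_sub (ν.integrable f) (ν.integrable g)).symm
  rw [this]
  exact ν.abs_pairing_le _

theorem SubProb.uniformContinuous_pairing (f : C(UnitAddCircle, ℝ)) :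
    UniformContinuous fun ν : SubProb => ν.pairing f :=
  have h : UniformContinuous SubProb.pairing := by
    change Tendsto _ (comap _ _) _
    exact tendsto_comap
  (Pi.uniformContinuous_proj (fun _ : C(UnitAddCircle, ℝ) => ℝ) f).comp h

/-- The integrals against a dense sequence of continuous functions. -/
def SubProb.denseEval (ν : SubProb) (i : ℕ) : ℝ :=
  ν.pairing (TopologicalSpace.denseSeq C(UnitAddCircle, ℝ) i)

/-- Masses are at most `1`, so pairings are 1-Lipschitz in `f` uniformly over `𝓜` and a dense
sequence controls them all. This makes the uniformities of `𝓜` and of the Skorohod space countably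
generated, as dominated convergence along neighbourhood filters requires. -/
theorem SubProb.isUniformInducing_denseEval : IsUniformInducing SubProb.denseEval := by
  refine ⟨le_antisymm (α := Filter (SubProb × SubProb)) ?_ ?_⟩
  · change _ ≤ comap (fun p : SubProb × SubProb => (p.1.pairing, p.2.pairing))
      (uniformity (C(UnitAddCircle, ℝ) → ℝ))
    have e : comap (fun p : SubProb × SubProb => (p.1.pairing, p.2.pairing))
        (uniformity (C(UnitAddCircle, ℝ) → ℝ)) =
        ⨅ f, comap (fun p : SubProb × SubProb => (p.1.pairing f, p.2.pairing f)) (uniformity ℝ) := by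
      rw [Pi.uniformity, comap_iInf]
      simp only [comap_comap, Function.comp_def]
    rw [e]
    refine le_iInf fun f => ?_
    rw [← tendsto_iff_comap, Metric.uniformity_basis_dist.tendsto_right_iff]
    intro ε hε
    obtain ⟨i, hi⟩ := Metric.denseRange_iff.1
      (TopologicalSpace.denseRange_denseSeq C(UnitAddCircle, ℝ)) f (ε / 3) (by positivity)
    have h1 : {p : (ℕ → ℝ) × (ℕ → ℝ) | dist (p.1 i) (p.2 i) < ε / 3} ∈ uniformity (ℕ → ℝ) :=
      Pi.uniformContinuous_proj (fun _ : ℕ => ℝ) i (Metric.dist_mem_uniformity (by positivity))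
    filter_upwards [preimage_mem_comap h1] with p hp
    simp only [mem_preimage, mem_ofPred_eq, SubProb.denseEval] at hp
    have e1 := p.1.abs_pairing_sub_le f (TopologicalSpace.denseSeq C(UnitAddCircle, ℝ) i)
    have e2 := p.2.abs_pairing_sub_le (TopologicalSpace.denseSeq C(UnitAddCircle, ℝ) i) f
    rw [← dist_eq_norm] at e1 e2
    rw [dist_comm] at e2
    rw [Real.dist_eq] at hp ⊢
    have e3 := abs_sub_le (p.1.pairing f)
      (p.1.pairing (TopologicalSpace.denseSeq C(UnitAddCircle, ℝ) i)) (p.2.pairing f)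
    have e4 := abs_sub_le (p.1.pairing (TopologicalSpace.denseSeq C(UnitAddCircle, ℝ) i))
      (p.2.pairing (TopologicalSpace.denseSeq C(UnitAddCircle, ℝ) i)) (p.2.pairing f)
    linarith
  · rw [← tendsto_iff_comap]
    exact uniformContinuous_pi.2 fun i => SubProb.uniformContinuous_pairing _

instance : IsCountablyGenerated (uniformity SubProb) := by
  rw [← SubProb.isUniformInducing_denseEval.comap_uniformity]
  infer_instance

theorem SubProb.continuous_pairing :
    Continuous fun p : SubProb × C(UnitAddCircle, ℝ) => p.1.pairing p.2 := by
  refine continuous_iff_continuousAt.2 fun p => ?_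
  rw [ContinuousAt, tendsto_iff_dist_tendsto_zero]
  have h : Tendsto (fun q : SubProb × C(UnitAddCircle, ℝ) =>
      dist q.2 p.2 + dist (q.1.pairing p.2) (p.1.pairing p.2)) (𝓝 p) (𝓝 (0 + 0)) := by
    refine Tendsto.add ?_ ?_
    · exact tendsto_iff_dist_tendsto_zero.1 (continuous_snd.tendsto p)
    · refine tendsto_iff_dist_tendsto_zero.1 ?_
      exact ((SubProb.uniformContinuous_pairing p.2).continuous.comp continuous_fst).tendsto p
  rw [add_zero] at h
  refine squeeze_zero (fun _ => dist_nonneg) (fun q => ?_) h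
  refine (dist_triangle _ (q.1.pairing p.2) _).trans (add_le_add_left ?_ _)
  rw [Real.dist_eq, dist_eq_norm]
  exact q.1.abs_pairing_sub_le _ _

/-! ### Càdlàg paths -/

/-- At a jump some rational `q` separates the left limit from the value. For fixed `q` and a fixed
direction, such jump times are isolated from the left, because just before one of them the path
stays on the side of the left limit. A set whose points are all left-isolated is countable. -/
theorem IsCadlag.countable_not_continuousAt {T : ℝ} {x : Icc (0 : ℝ) T → ℝ} (hx : IsCadlag x) :
    {t | ¬ContinuousAt x t}.Countable := by
  choose hr l hl using hx
  have hA : ∀ (q : ℚ) (A : Set (Icc (0 : ℝ) T)), (∀ t ∈ A, ∀ᶠ s in 𝓝[<] t, s ∉ A) →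
      A.Countable := by
    intro q A hA
    refine Set.Countable.mono ?_ (countable_setOfPred_isolated_left_within (s := A))
    intro t ht
    refine ⟨ht, ?_⟩
    have h1 := hA t ht
    rw [← empty_mem_iff_bot, inter_comm, nhdsWithin_inter']
    filter_upwards [mem_inf_of_left h1, mem_inf_of_right (mem_principal_self A)] with s hs hs'
    exact hs hs'
  have hsub : {t | ¬ContinuousAt x t} ⊆
      ⋃ q : ℚ, ({t | l t < q ∧ (q : ℝ) < x t} ∪ {t | (q : ℝ) < l t ∧ x t < q}) := by
    intro t ht
    have hne : l t ≠ x t := by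
      intro h
      refine ht ?_
      have h1 : Tendsto x (𝓝[<] t ⊔ 𝓝[≥] t) (𝓝 (x t)) :=
        Tendsto.sup (h ▸ hl t) (hr t)
      rwa [nhdsLT_sup_nhdsGE] at h1
    rcases hne.lt_or_gt with h | h
    · obtain ⟨q, h1, h2⟩ := exists_rat_btwn h
      exact mem_iUnion.2 ⟨q, Or.inl ⟨h1, h2⟩⟩
    · obtain ⟨q, h1, h2⟩ := exists_rat_btwn h
      exact mem_iUnion.2 ⟨q, Or.inr ⟨h2, h1⟩⟩
  refine (countable_iUnion fun q => Countable.union (hA q _ ?_) (hA q _ ?_)).mono hsub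
  · rintro t ⟨h1, _⟩
    filter_upwards [(hl t).eventually (gt_mem_nhds h1)] with s hs h2
    exact lt_asymm hs h2.2
  · rintro t ⟨h1, _⟩
    filter_upwards [(hl t).eventually (lt_mem_nhds h1)] with s hs h2
    exact lt_asymm hs h2.2

theorem IsCadlag.comp {ι E F : Type*} [TopologicalSpace ι] [Preorder ι] [TopologicalSpace E]
    [TopologicalSpace F] {x : ι → E} (hx : IsCadlag x) {f : E → F} (hf : Continuous f) :
    IsCadlag fun t => f (x t) := fun t =>
  ⟨(hf.tendsto _).comp (hx t).1, (hx t).2.elim fun l hl => ⟨f l, (hf.tendsto l).comp hl⟩⟩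

theorem SubProb.countable_not_continuousAt {T : ℝ} {x : Icc (0 : ℝ) T → SubProb}
    (hx : IsCadlag x) : {t | ¬ContinuousAt x t}.Countable := by
  have h : ∀ i, {t | ¬ContinuousAt (fun t => (x t).denseEval i) t}.Countable := fun i =>
    (hx.comp (SubProb.uniformContinuous_pairing _).continuous).countable_not_continuousAt
  refine (countable_iUnion h).mono fun t ht => ?_
  by_contra hc
  simp only [mem_iUnion, mem_ofPred_eq, not_exists, not_not] at hc
  refine ht ?_
  rw [SubProb.isUniformInducing_denseEval.isInducing.continuousAt_iff]
  exact continuousAt_pi.2 hc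

/-! ### The Skorohod topology -/

theorem hasBasis_uniformity_skorohod (T : ℝ) (E : Type*) [UniformSpace E] :
    (uniformity (SkorohodSpace T E)).HasBasis
      (fun p : ℝ × Set (E × E) => 0 < p.1 ∧ p.2 ∈ uniformity E)
      fun p => skorohodRel p.1 p.2 := by
  refine ⟨fun S => ?_⟩
  change S ∈ (skorohodBasis T E).filter ↔ _
  rw [FilterBasis.mem_filter_iff]
  constructor
  · rintro ⟨_, ⟨ε, hε, V, hV, rfl⟩, h⟩
    exact ⟨(ε, V), ⟨hε, hV⟩, h⟩
  · rintro ⟨⟨ε, V⟩, ⟨hε, hV⟩, h⟩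
    exact ⟨_, ⟨ε, hε, V, hV, rfl⟩, h⟩

theorem skorohodRel_mono {T : ℝ} {E : Type*} [UniformSpace E] {ε ε' : ℝ} {V V' : Set (E × E)}
    (hε : ε ≤ ε') (hV : V ⊆ V') : (skorohodRel ε V : Set (SkorohodSpace T E × _)) ⊆
      skorohodRel ε' V' := by
  rintro p ⟨r, h1, h2⟩
  exact ⟨r, fun t => (h1 t).trans hε, fun t => hV (h2 t)⟩

instance (T : ℝ) (E : Type*) [UniformSpace E] [IsCountablyGenerated (uniformity E)] :
    IsCountablyGenerated (uniformity (SkorohodSpace T E)) := by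
  obtain ⟨V, hV⟩ := (uniformity E).exists_antitone_basis
  have h : (uniformity (SkorohodSpace T E)).HasBasis (fun _ : ℕ => True)
      fun n => skorohodRel (1 / ((n : ℝ) + 1)) (V n) := by
    refine (hasBasis_uniformity_skorohod T E).to_hasBasis ?_ ?_
    · rintro ⟨ε, W⟩ ⟨hε, hW⟩
      obtain ⟨n, hn⟩ := exists_nat_one_div_lt hε
      obtain ⟨m, -, hm⟩ := hV.1.mem_iff.1 hW
      refine ⟨max n m, trivial, skorohodRel_mono ?_ ((hV.2 (le_max_right n m)).trans hm)⟩
      refine le_trans ?_ hn.le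
      gcongr
      exact le_max_left n m
    · intro n _
      exact ⟨(_, _), ⟨by positivity, hV.1.mem_of_mem trivial⟩, Subset.rfl⟩
  exact (⟨h, to_countable _⟩ : HasCountableBasis _ _ _).isCountablyGenerated

theorem SkorohodSpace.tendsto_apply {T : ℝ} {E : Type*} [UniformSpace E]
    (x : SkorohodSpace T E) {t : Icc (0 : ℝ) T} (ht : ContinuousAt x.1 t) :
    Tendsto (fun y : SkorohodSpace T E => y.1 t) (𝓝 x) (𝓝 (x.1 t)) := by
  refine Uniform.tendsto_nhds_right.2 fun V hV => ?_
  obtain ⟨W, hW, hWV⟩ := comp_mem_uniformity_sets hV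
  obtain ⟨ε, hε, h1⟩ := Metric.nhds_basis_closedBall.mem_iff.1 (Uniform.continuousAt_iff'_right.1 ht hW)
  have h2 : ∀ᶠ y in 𝓝 x, (x, y) ∈ (skorohodRel ε W : Set (SkorohodSpace T E × _)) :=
    Uniform.tendsto_nhds_right.1 (tendsto_id (x := 𝓝 x))
      ((hasBasis_uniformity_skorohod T E).mem_of_mem (i := (ε, W)) ⟨hε, hW⟩)
  refine h2.mono fun y ⟨r, hr1, hr2⟩ => ?_
  exact hWV ⟨x.1 (r t), h1 (by simpa [Subtype.dist_eq, Real.dist_eq] using hr1 t), hr2 t⟩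

/-- A bound required at all times does not see the bijective time change, so it is a closed
condition although evaluation at a fixed time is not continuous. -/
theorem isClosed_pairing_le (T : ℝ) (f : C(UnitAddCircle, ℝ)) (c : ℝ) :
    IsClosed {π : SkorohodSpace T SubProb | ∀ t, (π.1 t).pairing f ≤ c} := by
  refine isClosed_of_closure_subset fun π hπ t => le_of_forall_pos_le_add fun ε hε => ?_
  have hV : {p : SubProb × SubProb | dist (p.1.pairing f) (p.2.pairing f) < ε}
      ∈ uniformity SubProb :=
    SubProb.uniformContinuous_pairing f (Metric.dist_mem_uniformity hε)
  have h2 : ∀ᶠ y in 𝓝 π, (π, y) ∈ (skorohodRel 1 _ : Set (SkorohodSpace T SubProb × _)) :=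
    Uniform.tendsto_nhds_right.1 (tendsto_id (x := 𝓝 π))
      ((hasBasis_uniformity_skorohod T SubProb).mem_of_mem (i := (1, _)) ⟨one_pos, hV⟩)
  obtain ⟨y, ⟨r, -, h3⟩, h4⟩ := mem_closure_iff_nhds.1 hπ _ h2
  have h5 : dist ((π.1 (r (r.symm t))).pairing f) ((y.1 (r.symm t)).pairing f) < ε :=
    h3 (r.symm t)
  rw [OrderIso.apply_symm_apply, Real.dist_eq] at h5
  linarith [le_abs_self ((π.1 t).pairing f - (y.1 (r.symm t)).pairing f), h4 (r.symm t)]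

/-! ### Space-time functionals of a path -/

/-- The functional `π ↦ ∫₀ᵀ ∫ h(t,u) π_t(du) dt`. -/
def timePairing {T : ℝ} (h : C(Cylinder T, ℝ)) (π : SkorohodSpace T SubProb) : ℝ :=
  ∫ t, (π.1 t).pairing (h.curry t) ∂timeMeasure T

theorem norm_curry_le {T : ℝ} (h : C(Cylinder T, ℝ)) (t : Icc (0 : ℝ) T) : ‖h.curry t‖ ≤ ‖h‖ :=
  (ContinuousMap.norm_le _ (norm_nonneg _)).2 fun u => h.norm_coe_le_norm (t, u)

theorem measurable_pairing_curry {T : ℝ} (hT : 0 < T) (h : C(Cylinder T, ℝ))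
    (π : SkorohodSpace T SubProb) : Measurable fun t => (π.1 t).pairing (h.curry t) :=
  measurable_of_rightContinuous hT fun t =>
    (SubProb.continuous_pairing.tendsto (π.1 t, h.curry t)).comp
      ((π.2 t).1.prodMk (h.curry.continuous.continuousWithinAt (s := Ici t) (x := t)))

theorem integrable_pairing_curry {T : ℝ} (hT : 0 < T) (h : C(Cylinder T, ℝ))
    (π : SkorohodSpace T SubProb) :
    Integrable (fun t => (π.1 t).pairing (h.curry t)) (timeMeasure T) :=
  (integrable_const ‖h‖).mono' (measurable_pairing_curry hT h π).aestronglyMeasurable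
    (Eventually.of_forall fun t => ((π.1 t).abs_pairing_le _).trans (norm_curry_le h t))

instance (T : ℝ) : NullSingletonClass (timeMeasure T) := by
  refine ⟨fun t => ?_⟩
  rw [timeMeasure, (MeasurableEmbedding.subtype_coe measurableSet_Icc).comap_apply]
  simp

/-- Evaluation at `t` is continuous at `π` unless `π` jumps at `t`; jump times are countable, hence
Lebesgue-null, and dominated convergence applies. -/
theorem continuous_timePairing {T : ℝ} (hT : 0 < T) (h : C(Cylinder T, ℝ)) :
    Continuous (timePairing h) := by
  refine continuous_iff_continuousAt.2 fun π => ?_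
  refine tendsto_integral_filter_of_dominated_convergence (fun _ => ‖h‖)
    (Eventually.of_forall fun y => (measurable_pairing_curry hT h y).aestronglyMeasurable)
    (Eventually.of_forall fun y => Eventually.of_forall fun t =>
      ((y.1 t).abs_pairing_le _).trans (norm_curry_le h t)) (integrable_const _) ?_
  have h1 : ∀ᵐ t ∂timeMeasure T, ContinuousAt π.1 t :=
    (SubProb.countable_not_continuousAt π.2).measure_zero _
  filter_upwards [h1] with t ht
  exact (SubProb.continuous_pairing.tendsto (π.1 t, h.curry t)).comp
    ((π.tendsto_apply ht).prodMk_nhds tendsto_const_nhds)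

theorem abs_timePairing_le {T : ℝ} (hT : 0 < T) (h : C(Cylinder T, ℝ))
    (π : SkorohodSpace T SubProb) : |timePairing h π| ≤ T * ‖h‖ := by
  have := norm_integral_le_of_norm_le_const (μ := timeMeasure T)
    (f := fun t => (π.1 t).pairing (h.curry t)) (C := ‖h‖)
    (Eventually.of_forall fun t => ((π.1 t).abs_pairing_le _).trans (norm_curry_le h t))
  rwa [measureReal_def, timeMeasure_univ, ENNReal.toReal_ofReal hT.le, mul_comm] at this

/-! ### Riemann sums on the torus -/

theorem norm_coe_unitAddCircle_le (r : ℝ) : ‖(r : UnitAddCircle)‖ ≤ |r| :=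
  QuotientAddGroup.norm_mk_le_norm

theorem exists_norm_sub_toAddCircle_le (N : ℕ) [NeZero N] (u : UnitAddCircle) :
    ∃ x : ZMod N, ‖u - ZMod.toAddCircle x‖ ≤ 1 / N := by
  have hN : (0 : ℝ) < N := by exact_mod_cast NeZero.pos N
  obtain ⟨r, rfl⟩ := QuotientAddGroup.mk_surjective u
  refine ⟨(⌊r * N⌋ : ℤ), ?_⟩
  rw [ZMod.toAddCircle_intCast]
  refine (norm_coe_unitAddCircle_le (r - ⌊r * N⌋ / N)).trans ?_
  have e : r - ⌊r * N⌋ / N = (r * N - ⌊r * N⌋) / N := by field_simp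
  rw [e, abs_div, abs_of_pos hN, abs_of_nonneg (by linarith [Int.floor_le (r * N)])]
  gcongr
  linarith [Int.lt_floor_add_one (r * N)]

theorem eventually_one_div_lt {ε : ℝ} (hε : 0 < ε) : ∀ᶠ N : ℕ+ in atTop, 1 / (N : ℝ) < ε :=
  (tendsto_one_div_atTop_nhds_zero_nat.comp tendsto_PNat_val_atTop_atTop).eventually
    (gt_mem_nhds hε)

/-- The average `g` of the translates of `h` over the grid has the same integral as `h` and is
invariant under grid translations. Every point is within `1/N` of the grid, so uniform continuity
makes `g` nearly constant, and `g 0` is the Riemann sum. -/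
theorem tendsto_riemannSum (h : C(UnitAddCircle, ℝ)) :
    Tendsto (fun N : ℕ+ => (1 / (N : ℝ)) * ∑ x : ZMod N, h (ZMod.toAddCircle x)) atTop
      (𝓝 (∫ u, h u)) := by
  rw [Metric.tendsto_nhds]
  intro ε hε
  obtain ⟨δ, hδ, huc⟩ := Metric.uniformContinuous_iff.1
    (CompactSpace.uniformContinuous_of_continuous h.continuous) (ε / 2) (by positivity)
  filter_upwards [eventually_one_div_lt hδ] with N hN
  have hN0 : (0 : ℝ) < (N : ℕ) := by exact_mod_cast N.pos
  set g : UnitAddCircle → ℝ :=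
    fun u => (1 / (N : ℝ)) * ∑ x : ZMod N, h (u + ZMod.toAddCircle x) with hg
  have hint : ∀ x : ZMod N, Integrable (fun u => h (u + ZMod.toAddCircle x)) volume := fun x =>
    Continuous.integrable_of_hasCompactSupport (by fun_prop) (HasCompactSupport.of_compactSpace _)
  have h1 : ∫ u, g u = ∫ u, h u := by
    rw [hg, integral_const_mul, integral_finsetSum _ fun x _ => hint x]
    simp only [integral_add_right_eq_self (fun u => h u)]
    rw [Finset.sum_const, Finset.card_univ, ZMod.card, nsmul_eq_mul]
    field_simp
  have hgint : Integrable g volume := (integrable_finsetSum _ fun x _ => hint x).const_mul _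
  have h2 : ∀ u, |g 0 - g u| ≤ ε / 2 := by
    intro u
    obtain ⟨y, hy⟩ := exists_norm_sub_toAddCircle_le N u
    have e1 : g u = g (u - ZMod.toAddCircle y) := by
      simp only [hg]
      congr 1
      rw [← Equiv.sum_comp (Equiv.addLeft y) fun x : ZMod N => h (u - ZMod.toAddCircle y +
        ZMod.toAddCircle x)]
      refine Finset.sum_congr rfl fun x _ => ?_
      rw [Equiv.coe_addLeft, AddMonoidHom.map_add]
      congr 1
      abel
    rw [e1]
    simp only [hg]
    rw [← mul_sub, ← Finset.sum_sub_distrib, abs_mul, abs_of_pos (by positivity)]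
    calc 1 / (N : ℝ) * |∑ x : ZMod N, (h (0 + ZMod.toAddCircle x)
          - h (u - ZMod.toAddCircle y + ZMod.toAddCircle x))|
        ≤ 1 / (N : ℝ) * ∑ _x : ZMod N, ε / 2 := by
          gcongr
          refine (Finset.abs_sum_le_sum_abs _ _).trans (Finset.sum_le_sum fun x _ => ?_)
          rw [← Real.dist_eq]
          refine (huc ?_).le
          rw [dist_add_right, dist_zero_left]
          exact hy.trans_lt hN
      _ = ε / 2 := by
          rw [Finset.sum_const, Finset.card_univ, ZMod.card, nsmul_eq_mul]
          field_simp
  have h3 : (1 / (N : ℝ)) * ∑ x : ZMod N, h (ZMod.toAddCircle x) = g 0 := by simp [hg]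
  rw [h3, ← h1, Real.dist_eq]
  have h4 : g 0 - ∫ u, g u = ∫ u, (g 0 - g u) := by
    rw [integral_sub (integrable_const _) hgint]
    simp [measureReal_def]
  rw [h4]
  have h5 := norm_integral_le_of_norm_le_const (μ := (volume : Measure UnitAddCircle))
    (f := fun u => g 0 - g u) (Eventually.of_forall h2)
  rw [Real.norm_eq_abs, measureReal_def, UnitAddCircle.measure_univ] at h5
  simp only [ENNReal.toReal_one, mul_one] at h5
  linarith

theorem pairing_empirical {N : ℕ} [NeZero N] (η : Config N) (f : C(UnitAddCircle, ℝ)) :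
    (empirical η).pairing f = (1 / (N : ℝ)) * ∑ x : ZMod N, f (ZMod.toAddCircle x) * occ η x := by
  have h : (empirical η).toMeasure = empiricalMeasure η := rfl
  rw [SubProb.pairing, h, empiricalMeasure, integral_smul_measure, integral_finsetSum_measure]
  · simp only [ENNReal.toReal_inv, ENNReal.toReal_natCast, smul_eq_mul, one_div]
    congr 1
    refine Finset.sum_congr rfl fun x _ => ?_
    by_cases hx : η x <;> simp [hx, occ]
  · intro x _
    split_ifs
    · exact (BoundedContinuousFunction.mkOfCompact f).integrable _
    · exact integrable_zero_measure

/-! ### Test functions -/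

section TestFunctions

variable {T : ℝ} {B : Set UnitAddCircle}

/-- The space derivative of a test function as a continuous function. -/
def TorusTest.deriv (φ : TorusTest T B) : C(Cylinder T, ℝ) := ⟨φ.dH, φ.continuous_dH⟩

/-- The function `(t,u) ↦ N (H(t, u + 1/N) - H(t,u))`. -/
def TorusTest.discreteDeriv (φ : TorusTest T B) (N : ℕ) : C(Cylinder T, ℝ) where
  toFun p := N * (φ.H (p.1, p.2 + ((1 / N : ℝ) : UnitAddCircle)) - φ.H p)
  continuous_toFun := by
    have := φ.continuous_H
    fun_prop

theorem TorusTest.norm_discreteDeriv_sub_le (φ : TorusTest T B) {ε : ℝ} (hε : 0 < ε) :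
    ∀ᶠ N : ℕ+ in atTop, ‖φ.discreteDeriv N - φ.deriv‖ ≤ ε := by
  obtain ⟨δ, hδ, huc⟩ := Metric.uniformContinuous_iff.1
    (CompactSpace.uniformContinuous_of_continuous φ.continuous_dH) ε hε
  filter_upwards [eventually_one_div_lt hδ] with N hN
  have hN0 : (0 : ℝ) < (N : ℕ) := by exact_mod_cast N.pos
  refine (ContinuousMap.norm_le _ hε.le).2 fun p => ?_
  obtain ⟨t, u⟩ := p
  obtain ⟨r, rfl⟩ := QuotientAddGroup.mk_surjective u
  obtain ⟨s, hs, hs2⟩ := exists_hasDerivAt_eq_slope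
    (fun v : ℝ => φ.H (t, (v : UnitAddCircle))) (fun v : ℝ => φ.dH (t, (v : UnitAddCircle)))
    (show r < r + 1 / (N : ℕ) by linarith [show 0 < 1 / ((N : ℕ) : ℝ) by positivity])
    (fun v _ => (φ.hasDerivAt t v).continuousAt.continuousWithinAt)
    fun v _ => φ.hasDerivAt t v
  have e : (φ.discreteDeriv N - φ.deriv) (t, (r : UnitAddCircle))
      = φ.dH (t, (s : UnitAddCircle)) - φ.dH (t, (r : UnitAddCircle)) := by
    rw [hs2, ContinuousMap.sub_apply]
    simp only [TorusTest.discreteDeriv, TorusTest.deriv, ContinuousMap.coe_mk, AddCircle.coe_add]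
    congr 1
    field_simp
    ring
  refine le_of_eq_of_le (congrArg norm e) ?_
  rw [← dist_eq_norm]
  refine (huc ?_).le
  rw [Prod.dist_eq, dist_self, max_eq_right dist_nonneg, dist_eq_norm]
  refine lt_of_le_of_lt (norm_coe_unitAddCircle_le (s - r)) (lt_of_le_of_lt ?_ hN)
  rw [abs_of_pos (by linarith [hs.1])]
  linarith [hs.2]

theorem toAddCircle_add_one {N : ℕ} [NeZero N] (x : ZMod N) :
    ZMod.toAddCircle (x + 1) = ZMod.toAddCircle x + ((1 / N : ℝ) : UnitAddCircle) := by
  rw [map_add]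
  congr 1
  simpa using ZMod.toAddCircle_natCast (N := N) 1

/-- The closed support projects to a compact set at positive distance from the slow points, while
the right end point of a slow bond lies within `1/N` of one of them. -/
theorem TorusTest.eq_zero_of_isSlow {k : ℕ} {b : Fin k → ℝ} (φ : TorusTest T (slowPoints b)) :
    ∀ᶠ N : ℕ+ in atTop, ∀ t, ∀ x : ZMod N, IsSlow b x → φ.H (t, ZMod.toAddCircle (x + 1)) = 0 := by
  have hcl : IsClosed (Prod.snd '' tsupport φ.H) :=
    ((isClosed_tsupport φ.H).isCompact.image continuous_snd).isClosed
  have h1 : ∀ i, ∃ δ > 0, Metric.ball (b i : UnitAddCircle) δ ⊆ (Prod.snd '' tsupport φ.H)ᶜ := by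
    intro i
    refine Metric.isOpen_iff.1 hcl.isOpen_compl _ ?_
    rintro ⟨p, hp, hpi⟩
    exact (φ.support hp).2 ⟨i, hpi.symm⟩
  choose δ hδ hball using h1
  filter_upwards [eventually_all.2 fun i => eventually_one_div_lt (hδ i)] with N hN t x hx
  have hN0 : (0 : ℝ) < (N : ℕ) := by exact_mod_cast N.pos
  obtain ⟨i, r, hr, hri⟩ := hx
  refine image_eq_zero_of_notMem_tsupport fun hmem => ?_
  refine hball i ?_ ⟨_, hmem, rfl⟩
  rw [Metric.mem_ball, ← hri, toAddCircle_add_one, ZMod.toAddCircle_apply, ← AddCircle.coe_add,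
    dist_eq_norm]
  refine lt_of_le_of_lt (norm_coe_unitAddCircle_le _) (lt_of_le_of_lt ?_ (hN i))
  rw [← add_div, abs_of_nonneg (by linarith [hr.2])]
  have : ((x.val : ℝ) + 1) / (N : ℕ) = (x.val : ℝ) / (N : ℕ) + 1 / (N : ℕ) := add_div _ _ _
  linarith [hr.1]

/-- The functional `π ↦ ∫₀ᵀ ∫ ∂_u H dπ_t dt - 2 ∫₀ᵀ ∫ H² du dt`. -/
def TorusTest.functional (φ : TorusTest T B) (π : SkorohodSpace T SubProb) : ℝ :=
  timePairing φ.deriv π - 2 * ∫ p, φ.H p ^ 2 ∂cylinderMeasure T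

instance (T : ℝ) : IsFiniteMeasure (cylinderMeasure T) := by
  unfold cylinderMeasure
  infer_instance

theorem integrable_cylinder {f : Cylinder T → ℝ} (hf : Continuous f) :
    Integrable f (cylinderMeasure T) :=
  hf.integrable_of_hasCompactSupport (HasCompactSupport.of_compactSpace _)

theorem continuous_integral_time {f : Cylinder T → ℝ} (hf : Continuous f) :
    Continuous fun u => ∫ t, f (t, u) ∂timeMeasure T := by
  have := continuous_parametric_integral_of_continuous (μ := timeMeasure T)
    (f := fun (u : UnitAddCircle) (t : Icc (0 : ℝ) T) => f (t, u)) (s := univ)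
    (by fun_prop) isCompact_univ
  simpa using this

theorem timePairing_sub (hT : 0 < T) (h h' : C(Cylinder T, ℝ)) (π : SkorohodSpace T SubProb) :
    timePairing (h - h') π = timePairing h π - timePairing h' π := by
  rw [timePairing, timePairing, timePairing,
    ← integral_sub (integrable_pairing_curry hT h π) (integrable_pairing_curry hT h' π)]
  refine integral_congr_ae (Eventually.of_forall fun t => ?_)
  exact integral_sub ((π.1 t).integrable (h.curry t)) ((π.1 t).integrable (h'.curry t))

/-- The variational estimate is applied to `x ↦ H(t, x/N)`. Time integration turns the quadratic
term into a Riemann sum for `∫∫ H²`. -/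
theorem TorusTest.lintegral_exp_functional_le {k : ℕ} {β : ℝ} {b : Fin k → ℝ} (hT : 0 < T)
    {μ : ∀ N : ℕ+, Measure (Config N)} (hμ : ∀ N, IsProbabilityMeasure (μ N))
    {P : ∀ N : ℕ+, Measure (ConfigPath N)} (hP : ∀ N : ℕ+, IsExclusionLaw β b N (μ N) (P N))
    (φ : TorusTest T (slowPoints b)) {ε : ℝ} (hε : 0 < ε) :
    ∀ᶠ N : ℕ+ in atTop,
      ∫⁻ ω, ENNReal.ofReal (Real.exp (N * φ.functional (empiricalPath N T ω))) ∂P N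
        ≤ ENNReal.ofReal (2 ^ (N : ℕ) * Real.exp (N * ε)) := by
  have hHc := φ.continuous_H
  set G : C(UnitAddCircle, ℝ) := ⟨fun u => ∫ t, φ.H (t, u) ^ 2 ∂timeMeasure T,
    continuous_integral_time (hHc.pow 2)⟩ with hG
  have hG1 : ∫ p, φ.H p ^ 2 ∂cylinderMeasure T = ∫ u, G u :=
    integral_prod_symm _ (integrable_cylinder (hHc.pow 2))
  have hG0 : 0 ≤ ∫ u, G u := integral_nonneg fun u => integral_nonneg fun t => sq_nonneg _
  have hlim := (tendsto_riemannSum G).eventually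
    (gt_mem_nhds (show ∫ u, G u < (∫ u, G u) + ε by linarith))
  filter_upwards [hlim, φ.eq_zero_of_isSlow,
    φ.norm_discreteDeriv_sub_le (show 0 < ε / (2 * T) by positivity)] with N h1 h2 h3
  have hN0 : (0 : ℝ) < (N : ℕ) := by exact_mod_cast N.pos
  have := hμ N
  set h : Icc (0 : ℝ) T → ZMod N → ℝ := fun t x => φ.H (t, ZMod.toAddCircle x) with hh
  set w : Icc (0 : ℝ) T → Config N → ℝ := fun t η =>
    ∑ x, N * (h t (x + 1) - h t x) * occ η x - 1 / 2 * ∑ x, h t x ^ 2 with hw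
  have hmain := lintegral_exp_integral_le (hP N) hT w (fun η => by simp only [hw, hh]; fun_prop)
    fun t a => discreteDerivative_add_dirichlet_nonpos β b (h t) (fun x hx => h2 t x hx) a
  have hsq : ∀ x : ZMod N, Integrable (fun t => h t x ^ 2) (timeMeasure T) := fun x =>
    Continuous.integrable_of_hasCompactSupport (by simp only [hh]; fun_prop)
      (HasCompactSupport.of_compactSpace _)
  have hpt : ∀ ω : ConfigPath N, N * φ.functional (empiricalPath N T ω) ≤
      ∫ t, w t (ω.1 (toTime t)) ∂timeMeasure T + N * ε := by
    intro ω
    set π := empiricalPath N T ω with hπ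
    have e1 : ∫ t, w t (ω.1 (toTime t)) ∂timeMeasure T
        = N * timePairing (φ.discreteDeriv N) π - 1 / 2 * ∑ x : ZMod N, G (ZMod.toAddCircle x) := by
      have e2 : ∀ t, w t (ω.1 (toTime t))
          = N * (π.1 t).pairing ((φ.discreteDeriv N).curry t) - 1 / 2 * ∑ x, h t x ^ 2 := by
        intro t
        have e3 : π.1 t = empirical (ω.1 (toTime t)) := rfl
        rw [e3, pairing_empirical, ← mul_assoc, mul_one_div_cancel hN0.ne', one_mul]
        simp only [hw, hh, toAddCircle_add_one]
        rfl
      simp only [e2]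
      rw [integral_sub ((integrable_pairing_curry hT _ _).const_mul _)
        ((integrable_finsetSum _ fun x _ => hsq x).const_mul _), integral_const_mul,
        integral_const_mul, integral_finsetSum _ fun x _ => hsq x]
      rfl
    have e4 : timePairing φ.deriv π ≤ timePairing (φ.discreteDeriv N) π + ε / 2 := by
      have e5 := abs_timePairing_le hT (φ.discreteDeriv N - φ.deriv) π
      rw [timePairing_sub hT] at e5
      have e6 : T * ‖φ.discreteDeriv N - φ.deriv‖ ≤ ε / 2 := by
        calc _ ≤ T * (ε / (2 * T)) := by gcongr
          _ = ε / 2 := by field_simp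
      linarith [neg_le_of_abs_le e5]
    have e7 : ∑ x : ZMod N, G (ZMod.toAddCircle x) ≤ N * ((∫ u, G u) + ε) := by
      have := mul_le_mul_of_nonneg_left h1.le hN0.le
      rwa [← mul_assoc, mul_one_div_cancel hN0.ne', one_mul] at this
    -- Discretizing the derivative and the Riemann sum each cost `Nε/2`. Replacing the coefficient
    -- `½` of `∫∫ H²` by `2` only lowers the functional, by `hG0`.
    rw [e1, TorusTest.functional, hG1]
    have e8 := mul_le_mul_of_nonneg_left e4 hN0.le
    have e9 := mul_nonneg hN0.le hG0
    nlinarith [e7, e8, e9]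
  calc ∫⁻ ω, ENNReal.ofReal (Real.exp (N * φ.functional (empiricalPath N T ω))) ∂P N
      ≤ ∫⁻ ω, ENNReal.ofReal (Real.exp (∫ t, w t (ω.1 (toTime t)) ∂timeMeasure T)) *
          ENNReal.ofReal (Real.exp (N * ε)) ∂P N := by
        refine lintegral_mono fun ω => ?_
        rw [← ENNReal.ofReal_mul (Real.exp_pos _).le, ← Real.exp_add]
        exact ENNReal.ofReal_le_ofReal (Real.exp_le_exp.2 (hpt ω))
    _ = (∫⁻ ω, ENNReal.ofReal (Real.exp (∫ t, w t (ω.1 (toTime t)) ∂timeMeasure T)) ∂P N) *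
          ENNReal.ofReal (Real.exp (N * ε)) := lintegral_mul_const' _ _ ENNReal.ofReal_ne_top
    _ ≤ ENNReal.ofReal (2 ^ (N : ℕ)) * ENNReal.ofReal (Real.exp (N * ε)) := by gcongr
    _ = _ := (ENNReal.ofReal_mul (by positivity)).symm

end TestFunctions

/-! ### The expected energy of a limit point -/

section ExpectedEnergy

variable {T : ℝ} {B : Set UnitAddCircle}

/-- The zero test function. -/
def TorusTest.zero (T : ℝ) (B : Set UnitAddCircle) : TorusTest T B where
  H := 0
  dH := 0
  continuous_H := continuous_const
  continuous_dH := continuous_const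
  hasDerivAt _ u := hasDerivAt_const u 0
  support := by simp [tsupport]

theorem TorusTest.functional_zero (π : SkorohodSpace T SubProb) :
    (TorusTest.zero T B).functional π = 0 := by
  have h1 : timePairing (TorusTest.zero T B).deriv π = 0 := by
    refine (integral_congr_ae (Eventually.of_forall fun t => ?_)).trans (integral_zero _ _)
    exact (integral_congr_ae (Eventually.of_forall fun u => rfl)).trans (integral_zero _ _)
  have h2 : ∀ p, (TorusTest.zero T B).H p = 0 := fun _ => rfl
  simp [TorusTest.functional, h1, h2]

theorem TorusTest.continuous_functional (hT : 0 < T) (φ : TorusTest T B) :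
    Continuous φ.functional :=
  (continuous_timePairing hT _).sub continuous_const

theorem TorusTest.exists_abs_functional_le (hT : 0 < T) (φ : TorusTest T B) :
    ∃ C, ∀ π, |φ.functional π| ≤ C :=
  ⟨T * ‖φ.deriv‖ + |2 * ∫ p, φ.H p ^ 2 ∂cylinderMeasure T|, fun π =>
    (abs_sub _ _).trans (add_le_add_left (abs_timePairing_le hT _ π) _)⟩

theorem tendsto_atTop_of_strictMono_pnat {n : ℕ → ℕ+} (hn : StrictMono n) :
    Tendsto n atTop atTop := by
  refine tendsto_atTop.2 fun m => ?_
  filter_upwards [eventually_ge_atTop (m : ℕ)] with j hj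
  have h : StrictMono fun j => (n j : ℕ) := fun i j hij => hn hij
  exact PNat.coe_le_coe _ _ |>.1 (hj.trans (h.le_apply (x := j)))

theorem continuous_integral_cylinder :
    Continuous fun h : C(Cylinder T, ℝ) => ∫ p, h p ∂cylinderMeasure T := by
  refine (LipschitzWith.of_dist_le_mul (K := ((cylinderMeasure T).real univ).toNNReal)
    fun h h' => ?_).continuous
  rw [Real.dist_eq, dist_eq_norm, Real.coe_toNNReal _ measureReal_nonneg,
    ← integral_sub (integrable_cylinder h.continuous) (integrable_cylinder h'.continuous), mul_comm]
  exact norm_integral_le_of_norm_le_const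
    (Eventually.of_forall fun p => (h - h').norm_coe_le_norm p)

theorem continuous_timePairing_left (hT : 0 < T) (π : SkorohodSpace T SubProb) :
    Continuous fun h : C(Cylinder T, ℝ) => timePairing h π := by
  refine (LipschitzWith.of_dist_le_mul (K := T.toNNReal) fun h h' => ?_).continuous
  rw [Real.dist_eq, dist_eq_norm, Real.coe_toNNReal _ hT.le, ← timePairing_sub hT]
  exact abs_timePairing_le hT _ π

/-- The supremum of the energy functionals over all test functions. -/
def pathEnergy (B : Set UnitAddCircle) (π : SkorohodSpace T SubProb) : ℝ≥0∞ :=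
  ⨆ φ : TorusTest T B, ENNReal.ofReal (φ.functional π)

/-- An uncountable supremum of continuous functionals is still lower semicontinuous. -/
theorem measurable_pathEnergy (hT : 0 < T) :
    Measurable (pathEnergy B : SkorohodSpace T SubProb → ℝ≥0∞) :=
  (lowerSemicontinuous_iSup fun φ : TorusTest T B =>
    (ENNReal.continuous_ofReal.comp (φ.continuous_functional hT)).lowerSemicontinuous).measurable

/-- Through `(H, ∂_u H)` the test functions inherit a second countable topology from `C × C`, in
which the functional is continuous for fixed `π`; a dense sequence attains the supremum. -/
theorem exists_seq_pathEnergy_eq (hT : 0 < T) (B : Set UnitAddCircle) :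
    ∃ ψ : ℕ → TorusTest T B, ∀ π : SkorohodSpace T SubProb,
      pathEnergy B π = ⨆ n, ENNReal.ofReal ((ψ n).functional π) := by
  set e : TorusTest T B → C(Cylinder T, ℝ) × C(Cylinder T, ℝ) :=
    fun φ => (⟨φ.H, φ.continuous_H⟩, φ.deriv) with he
  let _ : TopologicalSpace (TorusTest T B) := TopologicalSpace.induced e inferInstance
  have hec : Continuous e := continuous_induced_dom
  have : SecondCountableTopology (TorusTest T B) :=
    TopologicalSpace.secondCountableTopology_induced _ _ e
  have : Nonempty (TorusTest T B) := ⟨TorusTest.zero T B⟩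
  refine ⟨TopologicalSpace.denseSeq (TorusTest T B), fun π => le_antisymm ?_ ?_⟩
  · refine iSup_le fun φ => ?_
    have hc : Continuous fun φ : TorusTest T B => φ.functional π := by
      have h1 := (continuous_timePairing_left hT π).comp (continuous_snd.comp hec)
      have h2 := continuous_integral_cylinder.comp ((continuous_fst.comp hec).pow 2)
      exact h1.sub (continuous_const.mul h2)
    refine (TopologicalSpace.denseRange_denseSeq (TorusTest T B)).induction_on
      (p := fun φ => ENNReal.ofReal (φ.functional π) ≤ _) φ
      (isClosed_le (ENNReal.continuous_ofReal.comp hc) continuous_const) fun n => ?_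
    exact le_iSup (fun n => ENNReal.ofReal
      ((TopologicalSpace.denseSeq (TorusTest T B) n).functional π)) n
  · exact iSup_le fun n => le_iSup (fun φ : TorusTest T B => ENNReal.ofReal (φ.functional π)) _

variable {k : ℕ} {β : ℝ} {b : Fin k → ℝ}

/-- The exponential of `N` times a maximum is at most the sum of the exponentials, so after Jensen
the maximum over `s` costs only `log |s| / N`. The maximum is bounded and continuous, so weak
convergence carries the bound to `Qs`. -/
theorem integral_sup'_functional_le (hT : 0 < T)
    {μ : ∀ N : ℕ+, Measure (Config N)} (hμ : ∀ N, IsProbabilityMeasure (μ N))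
    {P : ∀ N : ℕ+, Measure (ConfigPath N)} (hP : ∀ N : ℕ+, IsExclusionLaw β b N (μ N) (P N))
    {Q : ℕ+ → ProbabilityMeasure (SkorohodSpace T SubProb)}
    (hQ : ∀ N : ℕ+, HasLaw (empiricalPath N T) (Q N : Measure (SkorohodSpace T SubProb)) (P N))
    {Qs : ProbabilityMeasure (SkorohodSpace T SubProb)} {n : ℕ → ℕ+} (hn : StrictMono n)
    (hlim : Tendsto (fun j => Q (n j)) atTop (𝓝 Qs))
    (s : Finset (TorusTest T (slowPoints b))) (hs : s.Nonempty) :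
    Integrable (fun π => s.sup' hs fun φ => φ.functional π)
        (Qs : Measure (SkorohodSpace T SubProb)) ∧
      ∫ π, s.sup' hs (fun φ => φ.functional π) ∂(Qs : Measure (SkorohodSpace T SubProb))
        ≤ Real.log 2 := by
  set Ψ : SkorohodSpace T SubProb → ℝ := fun π => s.sup' hs fun φ => φ.functional π with hΨ
  have hΨc : Continuous Ψ :=
    Continuous.finset_sup'_apply hs fun φ _ => φ.continuous_functional hT
  choose C hC using fun φ : TorusTest T (slowPoints b) => φ.exists_abs_functional_le hT
  have hC0 : ∀ φ, 0 ≤ C φ := fun φ =>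
    (abs_nonneg _).trans (hC φ (empiricalPath 1 T ⟨fun _ _ => true, fun t =>
      ⟨continuousWithinAt_const, _, tendsto_const_nhds⟩⟩))
  have hΨb : ∀ π, |Ψ π| ≤ ∑ φ ∈ s, C φ := by
    intro π
    obtain ⟨φ, hφ, h⟩ := s.exists_mem_eq_sup' hs fun φ => φ.functional π
    simp only [hΨ]
    rw [h]
    exact (hC φ π).trans (Finset.single_le_sum (fun φ _ => hC0 φ) hφ)
  have hint : ∀ R : ProbabilityMeasure (SkorohodSpace T SubProb),
      Integrable Ψ (R : Measure (SkorohodSpace T SubProb)) := fun R =>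
    (integrable_const _).mono' hΨc.measurable.aestronglyMeasurable (Eventually.of_forall hΨb)
  refine ⟨hint Qs, ?_⟩
  have hbound : ∀ ε > 0, ∀ᶠ N : ℕ+ in atTop,
      ∫ π, Ψ π ∂(Q N : Measure (SkorohodSpace T SubProb)) ≤ Real.log 2 + 2 * ε := by
    intro ε hε
    have hs0 : (0 : ℝ) < s.card := by exact_mod_cast hs.card_pos
    have hcard : ∀ᶠ N : ℕ+ in atTop, Real.log s.card / (N : ℝ) < ε :=
      ((tendsto_const_div_atTop_nhds_zero_nat (Real.log s.card)).comp
        tendsto_PNat_val_atTop_atTop).eventually (gt_mem_nhds hε)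
    filter_upwards [hcard, (Finset.eventually_all s).2 fun φ (_ : φ ∈ s) =>
      φ.lintegral_exp_functional_le hT hμ hP hε] with N h1 h2
    have hN0 : (0 : ℝ) < (N : ℕ) := by exact_mod_cast N.pos
    set ν : Measure (SkorohodSpace T SubProb) := (Q N : Measure (SkorohodSpace T SubProb)) with hν
    have hexpc : Continuous fun π => Real.exp (N * Ψ π) := by fun_prop
    have hexpi : Integrable (fun π => Real.exp (N * Ψ π)) ν := by
      refine (integrable_const (Real.exp (N * ∑ φ ∈ s, C φ))).mono'
        hexpc.measurable.aestronglyMeasurable (Eventually.of_forall fun π => ?_)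
      rw [Real.norm_eq_abs, abs_of_pos (Real.exp_pos _)]
      gcongr
      exact (le_abs_self _).trans (hΨb π)
    have hle : ∫⁻ π, ENNReal.ofReal (Real.exp (N * Ψ π)) ∂ν
        ≤ ENNReal.ofReal (s.card * (2 ^ (N : ℕ) * Real.exp (N * ε))) := by
      calc ∫⁻ π, ENNReal.ofReal (Real.exp (N * Ψ π)) ∂ν
          ≤ ∫⁻ π, ∑ φ ∈ s, ENNReal.ofReal (Real.exp (N * φ.functional π)) ∂ν := by
            refine lintegral_mono fun π => ?_
            obtain ⟨φ, hφ, h⟩ := s.exists_mem_eq_sup' hs fun φ => φ.functional π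
            simp only [hΨ]
            rw [h]
            exact Finset.single_le_sum
              (f := fun φ => ENNReal.ofReal (Real.exp (N * φ.functional π)))
              (fun _ _ => zero_le) hφ
        _ = ∑ φ ∈ s, ∫⁻ π, ENNReal.ofReal (Real.exp (N * φ.functional π)) ∂ν := by
            refine lintegral_finsetSum _ fun φ _ => ?_
            exact ((φ.continuous_functional hT).measurable.const_mul _).exp.ennreal_ofReal
        _ ≤ ∑ φ ∈ s, ENNReal.ofReal (2 ^ (N : ℕ) * Real.exp (N * ε)) := by
            refine Finset.sum_le_sum fun φ hφ => ?_
            rw [hν, ← (hQ N).lintegral_comp (f := fun π =>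
              ENNReal.ofReal (Real.exp (N * φ.functional π)))
              ((φ.continuous_functional hT).measurable.const_mul _).exp.ennreal_ofReal.aemeasurable]
            exact h2 φ hφ
        _ = _ := by
            rw [Finset.sum_const, nsmul_eq_mul, ENNReal.ofReal_mul (p := (s.card : ℝ)) (by positivity),
              ENNReal.ofReal_natCast]
    rw [← ofReal_integral_eq_lintegral_ofReal hexpi
      (Eventually.of_forall fun _ => (Real.exp_pos _).le),
      ENNReal.ofReal_le_ofReal_iff (by positivity)] at hle
    have hJ : Real.exp (∫ π, N * Ψ π ∂ν) ≤ ∫ π, Real.exp (N * Ψ π) ∂ν :=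
      convexOn_exp.map_integral_le Real.continuous_exp.continuousOn isClosed_univ
        (Eventually.of_forall fun _ => mem_univ _) ((hint (Q N)).const_mul _) hexpi
    have hlog := Real.log_le_log (Real.exp_pos _) (hJ.trans hle)
    rw [Real.log_exp, integral_const_mul, Real.log_mul hs0.ne' (by positivity),
      Real.log_mul (by positivity) (by positivity), Real.log_pow, Real.log_exp] at hlog
    rw [div_lt_iff₀ hN0] at h1
    refine le_of_mul_le_mul_left ?_ hN0
    linarith
  have hconv : Tendsto (fun j => ∫ π, Ψ π ∂(Q (n j) : Measure (SkorohodSpace T SubProb))) atTop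
      (𝓝 (∫ π, Ψ π ∂(Qs : Measure (SkorohodSpace T SubProb)))) :=
    ProbabilityMeasure.tendsto_iff_forall_integral_tendsto.1 hlim
      (BoundedContinuousFunction.ofNormedAddCommGroup Ψ hΨc _ hΨb)
  refine le_of_forall_pos_le_add fun ε hε => ?_
  refine le_of_tendsto hconv ?_
  filter_upwards [(tendsto_atTop_of_strictMono_pnat hn).eventually (hbound (ε / 2) (by positivity))] with j hj
  linarith

theorem lintegral_pathEnergy_le (hT : 0 < T)
    {μ : ∀ N : ℕ+, Measure (Config N)} (hμ : ∀ N, IsProbabilityMeasure (μ N))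
    {P : ∀ N : ℕ+, Measure (ConfigPath N)} (hP : ∀ N : ℕ+, IsExclusionLaw β b N (μ N) (P N))
    {Q : ℕ+ → ProbabilityMeasure (SkorohodSpace T SubProb)}
    (hQ : ∀ N : ℕ+, HasLaw (empiricalPath N T) (Q N : Measure (SkorohodSpace T SubProb)) (P N))
    {Qs : ProbabilityMeasure (SkorohodSpace T SubProb)} {n : ℕ → ℕ+} (hn : StrictMono n)
    (hlim : Tendsto (fun j => Q (n j)) atTop (𝓝 Qs)) :
    ∫⁻ π, pathEnergy (slowPoints b) π ∂(Qs : Measure (SkorohodSpace T SubProb))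
      ≤ ENNReal.ofReal (Real.log 2) := by
  classical
  obtain ⟨ψ, hψ⟩ := exists_seq_pathEnergy_eq hT (slowPoints b)
  simp only [hψ]
  simp_rw [iSup_eq_iSup_finset fun i => ENNReal.ofReal ((ψ i).functional _)]
  have hmeas : ∀ i, Measurable fun π => ENNReal.ofReal ((ψ i).functional π) := fun i =>
    ((ψ i).continuous_functional hT).measurable.ennreal_ofReal
  rw [lintegral_iSup_directed_of_measurable]
  · refine iSup_le fun t => ?_
    -- The zero test function makes the family nonempty and its maximum nonnegative, so that
    -- `ENNReal.ofReal` commutes with the integral.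
    set s : Finset (TorusTest T (slowPoints b)) :=
      insert (TorusTest.zero T (slowPoints b)) (t.image ψ) with hsdef
    have hs : s.Nonempty := Finset.insert_nonempty _ _
    obtain ⟨h1, h2⟩ := integral_sup'_functional_le hT hμ hP hQ hn hlim s hs
    calc _ ≤ ∫⁻ π, ENNReal.ofReal (s.sup' hs fun φ => φ.functional π)
          ∂(Qs : Measure (SkorohodSpace T SubProb)) := by
          refine lintegral_mono fun π => iSup₂_le fun i hi => ENNReal.ofReal_le_ofReal ?_
          exact Finset.le_sup' (fun φ : TorusTest T (slowPoints b) => φ.functional π)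
            (Finset.mem_insert_of_mem (Finset.mem_image_of_mem ψ hi))
      _ ≤ _ := by
          rw [← ofReal_integral_eq_lintegral_ofReal h1 (Eventually.of_forall fun π => ?_)]
          · exact ENNReal.ofReal_le_ofReal h2
          · have := Finset.le_sup' (fun φ : TorusTest T (slowPoints b) => φ.functional π)
              (Finset.mem_insert_self (TorusTest.zero T (slowPoints b)) (t.image ψ))
            simp only [TorusTest.functional_zero] at this
            exact this
  · exact fun t => Measurable.biSup (t : Set ℕ) t.countable_toSet fun i _ => hmeas i
  · intro t t'
    exact ⟨t ∪ t', fun π => biSup_mono fun i hi => Finset.mem_union_left _ hi,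
      fun π => biSup_mono fun i hi => Finset.mem_union_right _ hi⟩

end ExpectedEnergy

/-! ### Densities of the limiting paths -/

section Density

variable {T : ℝ}

theorem pairing_empirical_le {N : ℕ} [NeZero N] (η : Config N) {f : C(UnitAddCircle, ℝ)}
    (hf : 0 ≤ f) :
    (empirical η).pairing f ≤ (1 / (N : ℝ)) * ∑ x : ZMod N, f (ZMod.toAddCircle x) := by
  rw [pairing_empirical]
  gcongr with x
  exact mul_le_of_le_one_right (hf _) (occ_mem_Icc η x).2

/-- Occupation numbers are at most `1`, so pairings are bounded by Riemann sums. The margin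
`1/(m+1)` gives the closed set probability one for large `N`, and the portmanteau theorem keeps this
in the limit. -/
theorem ae_pairing_le {P : ∀ N : ℕ+, Measure (ConfigPath N)}
    (hP : ∀ N, IsProbabilityMeasure (P N))
    {Q : ℕ+ → ProbabilityMeasure (SkorohodSpace T SubProb)}
    (hQ : ∀ N : ℕ+, HasLaw (empiricalPath N T) (Q N : Measure (SkorohodSpace T SubProb)) (P N))
    {Qs : ProbabilityMeasure (SkorohodSpace T SubProb)} {n : ℕ → ℕ+} (hn : StrictMono n)
    (hlim : Tendsto (fun j => Q (n j)) atTop (𝓝 Qs)) {f : C(UnitAddCircle, ℝ)} (hf : 0 ≤ f) :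
    ∀ᵐ π ∂(Qs : Measure (SkorohodSpace T SubProb)), ∀ t, (π.1 t).pairing f ≤ ∫ u, f u := by
  have key : ∀ m : ℕ, ∀ᵐ π ∂(Qs : Measure (SkorohodSpace T SubProb)), ∀ t,
      (π.1 t).pairing f ≤ (∫ u, f u) + 1 / ((m : ℝ) + 1) := by
    intro m
    set A := {π : SkorohodSpace T SubProb |
      ∀ t, (π.1 t).pairing f ≤ (∫ u, f u) + 1 / ((m : ℝ) + 1)} with hA
    have hAc : IsClosed A := isClosed_pairing_le T f _
    have hev : ∀ᶠ N : ℕ+ in atTop, (Q N : Measure (SkorohodSpace T SubProb)) A = 1 := by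
      filter_upwards [(tendsto_riemannSum f).eventually (gt_mem_nhds
        (show ∫ u, f u < (∫ u, f u) + 1 / ((m : ℝ) + 1) by
          linarith [show 0 < 1 / ((m : ℝ) + 1) by positivity]))] with N hN
      have := hP N
      rw [← (hQ N).measure_eq hAc.measurableSet]
      convert measure_univ (μ := P N) using 2
      exact eq_univ_of_forall fun ω t => (pairing_empirical_le _ hf).trans hN.le
    have h1 : (1 : ℝ≥0∞) ≤ (Qs : Measure (SkorohodSpace T SubProb)) A := by
      refine le_trans ?_ (ProbabilityMeasure.limsup_measure_closed_le_of_tendsto hlim hAc)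
      have h2 : (fun j => (Q (n j) : Measure (SkorohodSpace T SubProb)) A) =ᶠ[atTop] fun _ => 1 :=
        (tendsto_atTop_of_strictMono_pnat hn).eventually hev
      rw [limsup_congr h2, limsup_const]
    exact (mem_ae_iff_prob_eq_one hAc.measurableSet).2 (le_antisymm prob_le_one h1)
  filter_upwards [ae_all_iff.2 key] with π hπ t
  refine le_of_forall_pos_le_add fun ε hε => ?_
  obtain ⟨m, hm⟩ := exists_nat_one_div_lt hε
  linarith [hπ m t]

theorem SubProb.lintegral_eq_ofReal_pairing (ν : SubProb)
    (f : BoundedContinuousFunction UnitAddCircle ℝ≥0) :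
    ∫⁻ u, f u ∂ν.toMeasure =
      ENNReal.ofReal (ν.pairing ⟨fun u => (f u : ℝ), by fun_prop⟩) := by
  rw [SubProb.pairing, ofReal_integral_eq_lintegral_ofReal (ν.integrable _)
    (Eventually.of_forall fun u => (f u).2)]
  simp

/-- Continuous functions decreasing to indicators give the comparison on closed sets; inner
regularity gives it on Borel sets. -/
theorem SubProb.toMeasure_le_volume {ν : SubProb}
    (h : ∀ f : C(UnitAddCircle, ℝ), 0 ≤ f → ν.pairing f ≤ ∫ u, f u) : ν.toMeasure ≤ volume := by
  have hclosed : ∀ F : Set UnitAddCircle, IsClosed F → ν.toMeasure F ≤ volume F := by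
    intro F hF
    refine ge_of_tendsto (HasOuterApproxClosed.tendsto_lintegral_apprSeq hF volume)
      (Eventually.of_forall fun n => ?_)
    refine (HasOuterApproxClosed.measure_le_lintegral hF _ n).trans ?_
    rw [ν.lintegral_eq_ofReal_pairing]
    refine (ENNReal.ofReal_le_ofReal (h ⟨fun u => (hF.apprSeq n u : ℝ), by fun_prop⟩
      fun u => NNReal.coe_nonneg _)).trans (le_of_eq ?_)
    rw [ofReal_integral_eq_lintegral_ofReal]
    · simp
    · exact (BoundedContinuousFunction.mkOfCompact (⟨fun u => (hF.apprSeq n u : ℝ), by fun_prop⟩ :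
        C(UnitAddCircle, ℝ))).integrable _
    · exact Eventually.of_forall fun u => (hF.apprSeq n u).2
  refine Measure.le_iff.2 fun s hs => ?_
  rw [hs.measure_eq_iSup_isClosed_of_ne_top (measure_ne_top _ _)]
  exact iSup₂_le fun F hFs => iSup_le fun hF => (hclosed F hF).trans (measure_mono hFs)

theorem ae_toMeasure_le_volume {P : ∀ N : ℕ+, Measure (ConfigPath N)}
    (hP : ∀ N, IsProbabilityMeasure (P N))
    {Q : ℕ+ → ProbabilityMeasure (SkorohodSpace T SubProb)}
    (hQ : ∀ N : ℕ+, HasLaw (empiricalPath N T) (Q N : Measure (SkorohodSpace T SubProb)) (P N))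
    {Qs : ProbabilityMeasure (SkorohodSpace T SubProb)} {n : ℕ → ℕ+} (hn : StrictMono n)
    (hlim : Tendsto (fun j => Q (n j)) atTop (𝓝 Qs)) :
    ∀ᵐ π ∂(Qs : Measure (SkorohodSpace T SubProb)), ∀ t, (π.1 t).toMeasure ≤ volume := by
  -- Absolute values of a dense sequence approximate all nonnegative functions, so a single null set
  -- serves every `f`.
  set a : C(ℝ, ℝ) := ⟨fun x => |x|, continuous_abs⟩ with ha
  have h := ae_all_iff.2 fun i => ae_pairing_le hP hQ hn hlim
    (f := a.comp (TopologicalSpace.denseSeq C(UnitAddCircle, ℝ) i)) fun u => abs_nonneg _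
  filter_upwards [h] with π hπ t
  refine SubProb.toMeasure_le_volume fun f hf => ?_
  have hc1 : Continuous fun f : C(UnitAddCircle, ℝ) => (π.1 t).pairing (a.comp f) :=
    SubProb.continuous_pairing.comp (continuous_const.prodMk a.continuous_postcomp)
  have hc2 : Continuous fun f : C(UnitAddCircle, ℝ) => ∫ u, (a.comp f) u := by
    set ν : SubProb := ⟨⟨volume, inferInstance⟩, by
      refine ENNReal.toNNReal_mono (b := 1) ENNReal.one_ne_top ?_
      simp⟩ with hν
    exact SubProb.continuous_pairing.comp ((continuous_const (y := ν)).prodMk a.continuous_postcomp)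
  have := (TopologicalSpace.denseRange_denseSeq C(UnitAddCircle, ℝ)).induction_on
    (p := fun f => (π.1 t).pairing (a.comp f) ≤ ∫ u, (a.comp f) u) f (isClosed_le hc1 hc2) fun i => hπ i t
  have hfa : a.comp f = f := ContinuousMap.ext fun u => abs_of_nonneg (hf u)
  rwa [hfa] at this

theorem SkorohodSpace.measurable_toMeasure (hT : 0 < T) (π : SkorohodSpace T SubProb) :
    Measurable fun t => (π.1 t).toMeasure := by
  have hcont : ∀ f : C(UnitAddCircle, ℝ), Measurable fun t => (π.1 t).pairing f := fun f =>
    measurable_of_rightContinuous hT fun t =>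
      ((SubProb.uniformContinuous_pairing f).continuous.tendsto _).comp (π.2 t).1
  have hclosed : ∀ F : Set UnitAddCircle, IsClosed F →
      Measurable fun t => (π.1 t).toMeasure F := by
    intro F hF
    refine measurable_of_tendsto_metrizable (f := fun n t => ∫⁻ u, hF.apprSeq n u ∂(π.1 t).toMeasure)
      (fun n => ?_) (tendsto_pi_nhds.2 fun t =>
        HasOuterApproxClosed.tendsto_lintegral_apprSeq hF (π.1 t).toMeasure)
    simp only [SubProb.lintegral_eq_ofReal_pairing]
    exact (hcont _).ennreal_ofReal
  refine Measurable.measure_of_isPiSystem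
    ((BorelSpace.measurable_eq (α := UnitAddCircle)).trans borel_eq_generateFrom_isClosed)
    isPiSystem_isClosed (fun F hF => hclosed F hF) (hclosed univ isClosed_univ)

/-- The kernel form of Radon-Nikodym is used to obtain joint measurability in `(t,u)`; the
truncation at `1` makes the pointwise bound hold everywhere and changes nothing almost everywhere.
-/
theorem exists_isDensity (hT : 0 < T) {π : SkorohodSpace T SubProb}
    (h : ∀ t, (π.1 t).toMeasure ≤ volume) : ∃ ρ : Cylinder T → ℝ, IsDensity π ρ := by
  set κ : Kernel (Icc (0 : ℝ) T) UnitAddCircle :=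
    ⟨fun t => (π.1 t).toMeasure, π.measurable_toMeasure hT⟩ with hκ
  have : IsFiniteKernel κ := ⟨1, ENNReal.one_lt_top, fun t => (π.1 t).measure_univ_le⟩
  set ν : Kernel (Icc (0 : ℝ) T) UnitAddCircle := Kernel.const _ volume with hν
  have hm := Kernel.measurable_rnDeriv κ ν
  refine ⟨fun p => (min 1 (Kernel.rnDeriv κ ν p.1 p.2)).toReal,
    (measurable_const.min hm).ennreal_toReal, fun p => ⟨ENNReal.toReal_nonneg, ?_⟩, fun t => ?_⟩
  · exact ENNReal.toReal_le_of_le_ofReal zero_le_one (by simp)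
  · have h1 : ν.withDensity (Kernel.rnDeriv κ ν) t = κ t :=
      Kernel.withDensity_rnDeriv_eq (Measure.absolutelyContinuous_of_le (h t))
    rw [Kernel.withDensity_apply _ hm] at h1
    change κ t = _
    rw [← h1]
    refine withDensity_congr_ae ?_
    have h2 : κ t ≤ volume := h t
    filter_upwards [Kernel.rnDeriv_eq_rnDeriv_measure (κ := κ) (η := ν) (a := t),
      Measure.rnDeriv_le_one_of_le h2] with u h3 h4
    have h5 : Kernel.rnDeriv κ ν t u ≤ 1 := h3.le.trans h4
    rw [min_eq_right h5, ENNReal.ofReal_toReal (h5.trans_lt ENNReal.one_lt_top).ne]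

theorem IsDensity.integrable_mul {π : SkorohodSpace T SubProb} {ρ : Cylinder T → ℝ}
    (h : IsDensity π ρ) {f : Cylinder T → ℝ} (hf : Continuous f) :
    Integrable (fun p => f p * ρ p) (cylinderMeasure T) :=
  (integrable_cylinder hf).mul_bdd (c := 1) h.1.aestronglyMeasurable
    (Eventually.of_forall fun p => by
      rw [Real.norm_eq_abs, abs_of_nonneg (h.2.1 p).1]
      exact (h.2.1 p).2)

theorem IsDensity.timePairing_eq {π : SkorohodSpace T SubProb} {ρ : Cylinder T → ℝ}
    (h : IsDensity π ρ) (f : C(Cylinder T, ℝ)) :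
    timePairing f π = ∫ p, f p * ρ p ∂cylinderMeasure T := by
  rw [cylinderMeasure, integral_prod _ (h.integrable_mul f.continuous), timePairing]
  refine integral_congr_ae (Eventually.of_forall fun t => ?_)
  simp only [SubProb.pairing, h.2.2 t]
  rw [integral_withDensity_eq_integral_toReal_smul (f := fun u => ENNReal.ofReal (ρ (t, u)))
    (h.1.comp measurable_prodMk_left).ennreal_ofReal (Eventually.of_forall fun u => by simp)]
  refine integral_congr_ae (Eventually.of_forall fun u => ?_)
  simp only [ENNReal.toReal_ofReal (h.2.1 (t, u)).1, smul_eq_mul,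
    ContinuousMap.curry_apply]
  exact mul_comm _ _

/-- This makes the energy independent of the choice of density, so that measurability and the
expectation bound can be read off `pathEnergy`. -/
theorem IsDensity.energy_eq {π : SkorohodSpace T SubProb} {ρ : Cylinder T → ℝ}
    (h : IsDensity π ρ) (B : Set UnitAddCircle) : energy B ρ = pathEnergy B π := by
  refine iSup_congr fun φ => ?_
  rw [TorusTest.functional, h.timePairing_eq]
  rfl

end Density

/-! ### Weak derivatives from finite energy -/

/-- The bound makes `l` descend to a continuous functional on the range of `A`. Hahn-Banach extends
it, so the range need not be dense or closed, and Riesz represents it. -/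
theorem exists_inner_eq_of_abs_le {V E : Type*} [AddCommGroup V] [Module ℝ V]
    [NormedAddCommGroup E] [InnerProductSpace ℝ E] [CompleteSpace E] (A : V →ₗ[ℝ] E)
    (l : V →ₗ[ℝ] ℝ) {K : ℝ} (h : ∀ v, |l v| ≤ K * ‖A v‖) : ∃ g : E, ∀ v, l v = inner ℝ g (A v) := by
  have hker : LinearMap.ker A ≤ LinearMap.ker l := fun v hv => by
    have := h v
    rw [LinearMap.mem_ker.1 hv, norm_zero, mul_zero] at this
    exact abs_nonpos_iff.1 this
  set m : LinearMap.range A →ₗ[ℝ] ℝ :=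
    (LinearMap.ker A).liftQ l hker ∘ₗ A.quotKerEquivRange.symm.toLinearMap with hm
  have hmv : ∀ v, m ⟨A v, LinearMap.mem_range_self A v⟩ = l v := fun v => by
    simp only [hm, LinearMap.comp_apply, LinearEquiv.coe_coe]
    rw [LinearMap.quotKerEquivRange_symm_apply_image A v]
    simp
  obtain ⟨f, hf, -⟩ := exists_extension_norm_eq (LinearMap.range A)
    (m.mkContinuous K (by
      rintro ⟨_, v, rfl⟩
      rw [hmv]
      exact h v))
  refine ⟨(InnerProductSpace.toDual ℝ E).symm f, fun v => ?_⟩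
  rw [InnerProductSpace.toDual_symm_apply, ← hmv v]
  exact (hf ⟨A v, LinearMap.mem_range_self A v⟩).symm

section WeakDerivative

variable {T : ℝ} {B : Set UnitAddCircle}

/-- The pairs `(H, ∂_u H)` for `H` a test function. -/
def testPairs (T : ℝ) (B : Set UnitAddCircle) :
    Submodule ℝ ((Cylinder T → ℝ) × (Cylinder T → ℝ)) where
  carrier := {p | ∃ φ : TorusTest T B, φ.H = p.1 ∧ φ.dH = p.2}
  zero_mem' := ⟨TorusTest.zero T B, rfl, rfl⟩
  add_mem' := by
    rintro _ _ ⟨φ, h1, h2⟩ ⟨ψ, h3, h4⟩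
    exact ⟨{ H := φ.H + ψ.H
             dH := φ.dH + ψ.dH
             continuous_H := φ.continuous_H.add ψ.continuous_H
             continuous_dH := φ.continuous_dH.add ψ.continuous_dH
             hasDerivAt := fun t u => (φ.hasDerivAt t u).add (ψ.hasDerivAt t u)
             support := (tsupport_add _ _).trans (union_subset φ.support ψ.support) },
      by simp [h1, h3], by simp [h2, h4]⟩
  smul_mem' := by
    rintro c _ ⟨φ, h1, h2⟩
    exact ⟨{ H := c • φ.H
             dH := c • φ.dH
             continuous_H := φ.continuous_H.const_smul c
             continuous_dH := φ.continuous_dH.const_smul c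
             hasDerivAt := fun t u => (φ.hasDerivAt t u).const_smul c
             support := (closure_mono (Function.support_const_smul_subset c φ.H)).trans
              φ.support },
      by simp [h1], by simp [h2]⟩

theorem memLp_cylinder {f : Cylinder T → ℝ} (hf : Continuous f) :
    MemLp f 2 (cylinderMeasure T) :=
  (memLp_two_iff_integrable_sq hf.aestronglyMeasurable).2 (integrable_cylinder (hf.pow 2))

theorem IsDensity.exists_isWeakDeriv {π : SkorohodSpace T SubProb} {ρ : Cylinder T → ℝ}
    (hρ : IsDensity π ρ) (hE : energy B ρ ≠ ∞) : ∃ g, IsWeakDeriv B ρ g := by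
  have hH : ∀ v : testPairs T B, Continuous v.1.1 := by
    rintro ⟨_, φ, h1, -⟩
    exact h1 ▸ φ.continuous_H
  have hdH : ∀ v : testPairs T B, Continuous v.1.2 := by
    rintro ⟨_, φ, -, h2⟩
    exact h2 ▸ φ.continuous_dH
  set C := (energy B ρ).toReal with hC
  set l : testPairs T B →ₗ[ℝ] ℝ :=
    { toFun := fun v => ∫ p, v.1.2 p * ρ p ∂cylinderMeasure T
      map_add' := fun v w => by
        rw [← integral_add (hρ.integrable_mul (hdH v)) (hρ.integrable_mul (hdH w))]
        exact integral_congr_ae (Eventually.of_forall fun p => add_mul _ _ _)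
      map_smul' := fun c v => by
        rw [RingHom.id_apply, smul_eq_mul, ← integral_const_mul]
        exact integral_congr_ae (Eventually.of_forall fun p => mul_assoc _ _ _) } with hl
  set A : testPairs T B →ₗ[ℝ] Lp ℝ 2 (cylinderMeasure T) :=
    { toFun := fun v => (memLp_cylinder (hH v)).toLp v.1.1
      map_add' := fun v w => rfl
      map_smul' := fun c v => rfl } with hA
  have hAn : ∀ v, ‖A v‖ ^ 2 = ∫ p, v.1.1 p ^ 2 ∂cylinderMeasure T := by
    intro v
    rw [← real_inner_self_eq_norm_sq, L2.inner_def]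
    refine integral_congr_ae ?_
    filter_upwards [(memLp_cylinder (hH v)).coeFn_toLp] with p hp
    have : (A v) p = v.1.1 p := hp
    rw [this]
    simp [sq]
  have hbd : ∀ v, l v - 2 * ‖A v‖ ^ 2 ≤ C := by
    intro v
    rw [hAn]
    obtain ⟨⟨H, dH⟩, φ, h1, h2⟩ := v
    simp only at h1 h2
    subst h1 h2
    refine (ENNReal.ofReal_le_iff_le_toReal hE).1 ?_
    exact le_iSup (fun φ : TorusTest T B => ENNReal.ofReal
      ((∫ p, φ.dH p * ρ p ∂cylinderMeasure T) - 2 * ∫ p, φ.H p ^ 2 ∂cylinderMeasure T)) φ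
  have hle : ∀ v, |l v| ≤ √(8 * C) * ‖A v‖ := by
    -- Scaling `v` by `x` in `hbd` yields a quadratic in `x` that is never negative; its
    -- discriminant `(l v)² - 4 · 2‖A v‖² · C` is therefore at most zero, whence `8 C`.
    intro v
    have h1 : ∀ x : ℝ, 0 ≤ 2 * ‖A v‖ ^ 2 * (x * x) + (-l v) * x + C := by
      intro x
      have := hbd (x • v)
      rw [map_smul, map_smul, norm_smul, mul_pow, Real.norm_eq_abs, sq_abs, smul_eq_mul] at this
      linarith
    have h2 := discrim_le_zero h1
    rw [discrim] at h2
    have hC0 : 0 ≤ C := ENNReal.toReal_nonneg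
    refine abs_le_of_sq_le_sq ?_ (by positivity)
    rw [mul_pow, Real.sq_sqrt (by positivity)]
    linarith
  obtain ⟨g, hg⟩ := exists_inner_eq_of_abs_le A l hle
  refine ⟨fun p => -g p, (Lp.memLp g).neg, fun φ => ?_⟩
  have h1 := hg ⟨(φ.H, φ.dH), φ, rfl, rfl⟩
  have h2 : l ⟨(φ.H, φ.dH), φ, rfl, rfl⟩ = ∫ p, φ.dH p * ρ p ∂cylinderMeasure T := rfl
  rw [← h2, h1, L2.inner_def, ← integral_neg]
  refine integral_congr_ae ?_
  filter_upwards [(memLp_cylinder φ.continuous_H).coeFn_toLp] with p hp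
  have h3 : A ⟨(φ.H, φ.dH), φ, rfl, rfl⟩ p = φ.H p := hp
  rw [h3]
  simp [mul_comm]

end WeakDerivative

/-! ### Periodization of functions on an interval -/

section Periodize

variable {T a c : ℝ}

/-- The function on the torus that agrees with `F` on `[a, a+1)`. -/
def periodize (a : ℝ) (F : Icc (0 : ℝ) T × ℝ → ℝ) (p : Cylinder T) : ℝ :=
  F (p.1, (AddCircle.equivIco 1 a p.2 : ℝ))

theorem coe_sub_intCast (v : ℝ) (n : ℤ) : ((v - n : ℝ) : UnitAddCircle) = v := by
  rw [AddCircle.coe_sub, sub_eq_self]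
  exact AddCircle.coe_eq_zero_iff (1 : ℝ) |>.2 ⟨n, by simp⟩

/-- At most one of the two summands is nonzero. Keeping both gives one formula on a window around
the gluing point `a`, so continuity and differentiability there become local statements about `F`.
-/
theorem periodize_coe {F : Icc (0 : ℝ) T × ℝ → ℝ} (hF : ∀ t, ∀ u ∉ Ioo a (a + 1), F (t, u) = 0)
    (t : Icc (0 : ℝ) T) (n : ℤ) {v : ℝ} (hv : v - n ∈ Ioo (a - 1) (a + 1)) :
    periodize a F (t, (v : UnitAddCircle)) = F (t, v - n) + F (t, v - n + 1) := by
  rcases le_or_gt a (v - n) with h | h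
  · have h1 : (AddCircle.equivIco 1 a (v : UnitAddCircle) : ℝ) = v - n := by
      rw [← coe_sub_intCast v n]
      exact AddCircle.equivIco_coe_of_mem (p := (1 : ℝ)) ⟨h, hv.2⟩
    rw [hF t (v - n + 1) fun h' => by linarith [h'.2], add_zero, periodize, h1]
  · have h1 : (AddCircle.equivIco 1 a (v : UnitAddCircle) : ℝ) = v - n + 1 := by
      rw [← coe_sub_intCast v (n - 1)]
      have e : v - ((n - 1 : ℤ) : ℝ) = v - n + 1 := by push_cast; ring
      rw [e]
      exact AddCircle.equivIco_coe_of_mem (p := (1 : ℝ)) ⟨by linarith [hv.1], by linarith⟩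
    rw [hF t (v - n) fun h' => by linarith [h'.1], zero_add, periodize, h1]

theorem exists_int_eventually_mem (a u : ℝ) :
    ∃ n : ℤ, ∀ᶠ v : ℝ in 𝓝 u, v - (n : ℝ) ∈ Ioo (a - 1) (a + 1) := by
  refine ⟨⌊u - a⌋, ?_⟩
  have h1 := Int.floor_le (u - a)
  have h2 := Int.lt_floor_add_one (u - a)
  have hc : ContinuousAt (fun v : ℝ => v - ⌊u - a⌋) u := by fun_prop
  exact hc.eventually_mem (Ioo_mem_nhds (by linarith) (by linarith))

theorem isQuotientMap_prod_coe : IsQuotientMap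
    (Prod.map id (fun u : ℝ => (u : UnitAddCircle)) : Icc (0 : ℝ) T × ℝ → Cylinder T) :=
  (IsOpenQuotientMap.id.prodMap QuotientAddGroup.isOpenQuotientMap_mk).isQuotientMap

theorem continuous_periodize {F : Icc (0 : ℝ) T × ℝ → ℝ}
    (hF : ∀ t, ∀ u ∉ Ioo a (a + 1), F (t, u) = 0) (hc : Continuous F) :
    Continuous (periodize a F) := by
  rw [isQuotientMap_prod_coe.continuous_iff, continuous_iff_continuousAt]
  rintro ⟨t, u⟩
  obtain ⟨n, hn⟩ := exists_int_eventually_mem a u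
  have hcont : Continuous fun p : Icc (0 : ℝ) T × ℝ =>
      F (p.1, p.2 - n) + F (p.1, p.2 - n + 1) := by fun_prop
  refine hcont.continuousAt.congr ?_
  filter_upwards [(continuous_snd.tendsto (t, u)).eventually hn] with p hp
  exact (periodize_coe hF p.1 n hp).symm

/-- As `F` vanishes off `(a,c)`, the strip may be replaced by a full period, on which the quotient
map preserves measure. -/
theorem integral_strip_eq {F : Icc (0 : ℝ) T × ℝ → ℝ} (hca : c ≤ a + 1)
    (hF : ∀ t, ∀ u ∉ Ioo a c, F (t, u) = 0) (hc : Continuous F) {h : Cylinder T → ℝ}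
    (hh : AEStronglyMeasurable h (cylinderMeasure T)) :
    ∫ p, F p * h (p.1, (p.2 : UnitAddCircle)) ∂stripMeasure T a c
      = ∫ p, periodize a F p * h p ∂cylinderMeasure T := by
  have hF' : ∀ t, ∀ u ∉ Ioo a (a + 1), F (t, u) = 0 := fun t u hu =>
    hF t u fun h' => hu ⟨h'.1, h'.2.trans_le hca⟩
  have hmp : MeasurePreserving (Prod.map id (fun u : ℝ => (u : UnitAddCircle)))
      ((timeMeasure T).prod (volume.restrict (Ioc a (a + 1)))) (cylinderMeasure T) :=
    (MeasurePreserving.id _).prod (UnitAddCircle.measurePreserving_mk a)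
  have hres : ∀ s : Set ℝ, (timeMeasure T).prod (volume.restrict s)
      = ((timeMeasure T).prod volume).restrict (univ ×ˢ s) := fun s => by
    rw [← Measure.prod_restrict, Measure.restrict_univ]
  have hset : ∀ s : Set ℝ, Ioo a c ⊆ s →
      ∫ p, F p * h (p.1, (p.2 : UnitAddCircle)) ∂(timeMeasure T).prod (volume.restrict s)
        = ∫ p, F p * h (p.1, (p.2 : UnitAddCircle)) ∂(timeMeasure T).prod volume := by
    intro s hs
    rw [hres]
    refine setIntegral_eq_integral_of_forall_compl_eq_zero ?_
    rintro ⟨t, u⟩ hu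
    rw [hF t u fun h' => hu ⟨mem_univ _, hs h'⟩, zero_mul]
  rw [stripMeasure, hset _ Ioo_subset_Icc_self,
    ← hset (Ioc a (a + 1)) (Ioo_subset_Ioc_self.trans (Ioc_subset_Ioc_right hca))]
  rw [← hmp.map_eq, integral_map hmp.measurable.aemeasurable]
  · have hae : ∀ᵐ p ∂(timeMeasure T).prod (volume.restrict (Ioc a (a + 1))),
        p.2 ∈ Ioc a (a + 1) := by
      rw [hres]
      filter_upwards [ae_restrict_mem (MeasurableSet.univ.prod measurableSet_Ioc)] with p hp
      exact hp.2
    refine integral_congr_ae ?_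
    filter_upwards [hae] with p hp
    obtain ⟨t, u⟩ := p
    have h1 : periodize a F (t, (u : UnitAddCircle)) = F (t, u) := by
      rcases hp.2.eq_or_lt with h2 | h2
      -- The end point `a + 1` lies in the period `Ioc` but is represented by `a` in `Ico`; both
      -- sides vanish there.
      · have h3 : u = a + 1 := h2
        rw [periodize_coe hF' t 1 (by rw [h3]; simp)]
        rw [hF' t u fun h' => by linarith [h'.2],
          hF' t _ fun h' => by simp [h3] at h', hF' t _ fun h' => by simp [h3] at h', add_zero]
      · rw [periodize_coe hF' t 0 (by simp only [Int.cast_zero, sub_zero]; exact ⟨by linarith [hp.1], h2⟩)]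
        rw [hF' t (u - (0 : ℤ) + 1) fun h' => by
          have := h'.2
          simp only [Int.cast_zero, sub_zero] at this
          linarith [hp.1]]
        simp
    simp only [Prod.map_apply, id_eq, h1]
  · rw [hmp.map_eq]
    exact (continuous_periodize hF' hc).aestronglyMeasurable.mul hh

theorem IntervalTest.eq_zero (φ : IntervalTest T a c) (t : Icc (0 : ℝ) T) {u : ℝ}
    (hu : u ∉ Ioo a c) : φ.H (t, u) = 0 ∧ φ.dH (t, u) = 0 := by
  have h1 : (t, u) ∉ tsupport φ.H := fun h => hu (φ.support h).2
  refine ⟨image_eq_zero_of_notMem_tsupport h1, ?_⟩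
  have h2 : (fun v : ℝ => φ.H (t, v)) =ᶠ[𝓝 u] fun _ => 0 := by
    have h3 := notMem_tsupport_iff_eventuallyEq.1 h1
    have h4 : ContinuousAt (fun v : ℝ => (t, v)) u := by fun_prop
    exact h4.eventually h3
  exact (φ.hasDerivAt t u).unique ((hasDerivAt_const u (0 : ℝ)).congr_of_eventuallyEq h2)

/-- The periodization of a test function on an interval. -/
def IntervalTest.toTorusTest (φ : IntervalTest T a c) (hca : c ≤ a + 1) {B : Set UnitAddCircle}
    (hB : ∀ u ∈ Ioo a c, (u : UnitAddCircle) ∉ B) : TorusTest T B where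
  H := periodize a φ.H
  dH := periodize a φ.dH
  continuous_H := continuous_periodize
    (fun t _ hu => (φ.eq_zero t fun h => hu ⟨h.1, h.2.trans_le hca⟩).1) φ.continuous_H
  continuous_dH := continuous_periodize
    (fun t _ hu => (φ.eq_zero t fun h => hu ⟨h.1, h.2.trans_le hca⟩).2) φ.continuous_dH
  hasDerivAt t u := by
    obtain ⟨n, hn⟩ := exists_int_eventually_mem a u
    have h0 : ∀ t, ∀ u ∉ Ioo a (a + 1), φ.H (t, u) = 0 ∧ φ.dH (t, u) = 0 := fun t u hu =>
      φ.eq_zero t fun h => hu ⟨h.1, h.2.trans_le hca⟩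
    rw [periodize_coe (fun t u hu => (h0 t u hu).2) t n hn.self_of_nhds]
    have h1 : HasDerivAt (fun v : ℝ => φ.H (t, v - n) + φ.H (t, v - n + 1))
        (φ.dH (t, u - n) + φ.dH (t, u - n + 1)) u := by
      refine ((φ.hasDerivAt t (u - n)).comp_sub_const u n).add ?_
      have h2 := (φ.hasDerivAt t (u - n + 1)).comp_add_const (u - n) 1
      exact h2.comp_sub_const u n
    refine h1.congr_of_eventuallyEq ?_
    filter_upwards [hn] with v hv
    exact periodize_coe (fun t u hu => (h0 t u hu).1) t n hv
  support := by
    set e : Icc (0 : ℝ) T × ℝ → Cylinder T :=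
      Prod.map id (fun u : ℝ => (u : UnitAddCircle)) with he
    -- Compactness of the support is what makes its image on the torus closed, hence large enough to
    -- contain the closed support of the periodization.
    have hcl : IsClosed (e '' tsupport φ.H) :=
      (IsCompact.image φ.compactSupport isQuotientMap_prod_coe.continuous).isClosed
    refine (closure_minimal (fun p hp => ?_) hcl).trans ?_
    · exact ⟨(p.1, (AddCircle.equivIco 1 a p.2 : ℝ)), subset_tsupport _ hp,
        Prod.ext rfl AddCircle.coe_equivIco⟩
    · rintro _ ⟨p, hp, rfl⟩
      exact ⟨mem_univ _, hB _ (φ.support hp).2⟩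

theorem IsDensity.memL2H1 {π : SkorohodSpace T SubProb} {ρ g : Cylinder T → ℝ}
    (hρ : IsDensity π ρ) {B : Set UnitAddCircle} (hg : IsWeakDeriv B ρ g) (hca : c ≤ a + 1)
    (hB : ∀ u ∈ Ioo a c, (u : UnitAddCircle) ∉ B) :
    MemL2H1 T a c fun p => ρ (p.1, (p.2 : UnitAddCircle)) := by
  have hmp : MeasurePreserving (Prod.map id (fun u : ℝ => (u : UnitAddCircle)))
      ((timeMeasure T).prod (volume.restrict (Ioc a (a + 1)))) (cylinderMeasure T) :=
    (MeasurePreserving.id _).prod (UnitAddCircle.measurePreserving_mk a)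
  have hle : stripMeasure T a c ≤ (timeMeasure T).prod (volume.restrict (Ioc a (a + 1))) := by
    rw [stripMeasure, ← Measure.restrict_congr_set (Ioc_ae_eq_Icc (μ := volume) (a := a) (b := c))]
    exact Measure.prod_mono le_rfl (Measure.restrict_mono (Ioc_subset_Ioc_right hca) le_rfl)
  have hlp : ∀ {f : Cylinder T → ℝ}, MemLp f 2 (cylinderMeasure T) →
      MemLp (fun p : Icc (0 : ℝ) T × ℝ => f (p.1, (p.2 : UnitAddCircle))) 2 (stripMeasure T a c) :=
    fun hf => (hf.comp_measurePreserving hmp).mono_measure hle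
  have hρ2 : MemLp ρ 2 (cylinderMeasure T) :=
    (memLp_const (1 : ℝ)).mono hρ.1.aestronglyMeasurable (Eventually.of_forall fun p => by
      rw [Real.norm_eq_abs, abs_of_nonneg (hρ.2.1 p).1]
      simpa using (hρ.2.1 p).2)
  refine ⟨hlp hρ2, _, hlp hg.1, fun φ => ?_⟩
  rw [integral_strip_eq hca (fun t u hu => (φ.eq_zero t hu).2) φ.continuous_dH
    hρ.1.aestronglyMeasurable, integral_strip_eq hca (fun t u hu => (φ.eq_zero t hu).1)
    φ.continuous_H hg.1.1]
  exact hg.2 (φ.toTorusTest hca hB)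

end Periodize

/-! ### The arcs between consecutive slow points -/

theorem nextPoint_le_add_one {k : ℕ} {b : Fin k → ℝ} (hb : StrictMono b)
    (hb01 : ∀ i, b i ∈ Ico (0 : ℝ) 1) (i j : Fin k) : nextPoint b i ≤ b j + 1 := by
  unfold nextPoint
  split_ifs
  · linarith [(hb01 ⟨i + 1, by assumption⟩).2, (hb01 j).1]
  · have : b ⟨0, i.pos⟩ ≤ b j := hb.monotone (Fin.mk_le_of_le_val (Nat.zero_le _))
    linarith

theorem nextPoint_le_of_lt {k : ℕ} {b : Fin k → ℝ} (hb : StrictMono b) {i j : Fin k}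
    (hij : i < j) : nextPoint b i ≤ b j := by
  have h : (i : ℕ) + 1 ≤ j := hij
  rw [nextPoint, dif_pos (h.trans_lt j.2)]
  exact hb.monotone (Fin.mk_le_of_le_val h)

/-- If `u` and `b j` define the same torus point, then `u - b j` is an integer. It lies strictly
between `-1` and `0` when `i < j`, and strictly between `0` and `1` when `j ≤ i`. -/
theorem coe_notMem_slowPoints {k : ℕ} {b : Fin k → ℝ} (hb : StrictMono b)
    (hb01 : ∀ i, b i ∈ Ico (0 : ℝ) 1) (i : Fin k) {u : ℝ} (hu : u ∈ Ioo (b i) (nextPoint b i)) :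
    (u : UnitAddCircle) ∉ slowPoints b := by
  rintro ⟨j, hj⟩
  obtain ⟨m, hm⟩ := (AddCircle.coe_eq_zero_iff (1 : ℝ)).1
    (show ((u - b j : ℝ) : UnitAddCircle) = 0 by rw [AddCircle.coe_sub, sub_eq_zero]; exact hj.symm)
  have hm' : (m : ℝ) = u - b j := by simpa using hm
  rcases lt_or_ge i j with hij | hij
  · have h1 := nextPoint_le_of_lt hb hij
    have h2 : (m : ℝ) < 0 := by linarith [hu.2]
    have h3 : m ≤ -1 := by
      have : m < 0 := by exact_mod_cast h2
      omega
    have h4 : (m : ℝ) ≤ -1 := by exact_mod_cast h3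
    linarith [hu.1, (hb01 i).1, (hb01 j).2]
  · have h1 := nextPoint_le_add_one hb hb01 i j
    have h0 := hb.monotone hij
    have h2 : (0 : ℝ) < m := by linarith [hu.1]
    have h3 : 1 ≤ m := by
      have : 0 < m := by exact_mod_cast h2
      omega
    have h4 : (1 : ℝ) ≤ m := by exact_mod_cast h3
    linarith [hu.2]

end

end SlowBond

/-! ### Assembly of the theorem -/

theorem mainTheorem3 (β : ℝ) (hβ : 1 < β) (T : ℝ) (hT : 0 < T)
    (k : ℕ) (b : Fin k → ℝ) (hb : StrictMono b) (hb01 : ∀ i, b i ∈ Set.Ico (0 : ℝ) 1)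
    (γ : UnitAddCircle → ℝ) (hγ : Continuous γ) (hγ01 : ∀ u, γ u ∈ Set.Icc (0 : ℝ) 1)
    (μ : ∀ N : ℕ+, Measure (SlowBond.Config N)) (hμ : ∀ N, IsProbabilityMeasure (μ N))
    (hμγ : SlowBond.IsAssociated μ γ)
    (P : ∀ N : ℕ+, Measure (SlowBond.ConfigPath N))
    (hP : ∀ N : ℕ+, SlowBond.IsExclusionLaw β b N (μ N) (P N))
    (Q : ℕ+ → ProbabilityMeasure (SlowBond.SkorohodSpace T SlowBond.SubProb))
    (hQ : ∀ N : ℕ+, HasLaw (SlowBond.empiricalPath N T)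
      (Q N : Measure (SlowBond.SkorohodSpace T SlowBond.SubProb)) (P N))
    (Qs : ProbabilityMeasure (SlowBond.SkorohodSpace T SlowBond.SubProb))
    (hQs : ∃ n : ℕ → ℕ+, StrictMono n ∧ Tendsto (fun j => Q (n j)) atTop (𝓝 Qs)) :
    ∃ ρ : SlowBond.SkorohodSpace T SlowBond.SubProb → SlowBond.Cylinder T → ℝ,
      (∀ᵐ π ∂(Qs : Measure (SlowBond.SkorohodSpace T SlowBond.SubProb)),
        SlowBond.IsDensity π (ρ π) ∧
        (∃ g, SlowBond.IsWeakDeriv (SlowBond.slowPoints b) (ρ π) g) ∧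
        ∀ i, SlowBond.MemL2H1 T (b i) (SlowBond.nextPoint b i)
          (fun p => ρ π (p.1, (p.2 : UnitAddCircle)))) ∧
      AEMeasurable (fun π => SlowBond.energy (SlowBond.slowPoints b) (ρ π))
        (Qs : Measure (SlowBond.SkorohodSpace T SlowBond.SubProb)) ∧
      ∀ α ∈ Set.Ioo (0 : ℝ) 1,
        (∃ K₀, SlowBond.IsEntropyConstant α K₀) ∧
        ∀ K₀, SlowBond.IsEntropyConstant α K₀ →
          ∫⁻ π, SlowBond.energy (SlowBond.slowPoints b) (ρ π)
            ∂(Qs : Measure (SlowBond.SkorohodSpace T SlowBond.SubProb)) ≤ ENNReal.ofReal K₀ := by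
  classical
  obtain ⟨n, hn, hlim⟩ := hQs
  have hE := SlowBond.lintegral_pathEnergy_le hT hμ hP hQ hn hlim
  have hD := SlowBond.ae_toMeasure_le_volume (fun N => (hP N).isProbabilityMeasure) hQ hn hlim
  have hfin : ∀ᵐ π ∂(Qs : Measure (SlowBond.SkorohodSpace T SlowBond.SubProb)),
      SlowBond.pathEnergy (SlowBond.slowPoints b) π < ∞ :=
    ae_lt_top (SlowBond.measurable_pathEnergy hT) (hE.trans_lt ENNReal.ofReal_lt_top).ne
  -- The density is chosen path by path, with value zero where none exists. No measurability in `π`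
  -- results from this choice; that of the energy comes from its almost sure equality with
  -- `pathEnergy`.
  set ρ : SlowBond.SkorohodSpace T SlowBond.SubProb → SlowBond.Cylinder T → ℝ := fun π =>
    if h : ∃ ρ, SlowBond.IsDensity π ρ then h.choose else 0 with hρ
  have hdens : ∀ᵐ π ∂(Qs : Measure (SlowBond.SkorohodSpace T SlowBond.SubProb)),
      SlowBond.IsDensity π (ρ π) := by
    filter_upwards [hD] with π hπ
    have h := SlowBond.exists_isDensity hT hπ
    simp only [hρ, dif_pos h]
    exact h.choose_spec
  have henergy : (fun π => SlowBond.energy (SlowBond.slowPoints b) (ρ π)) =ᵐ[(Qs :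
      Measure (SlowBond.SkorohodSpace T SlowBond.SubProb))]
      SlowBond.pathEnergy (SlowBond.slowPoints b) := by
    filter_upwards [hdens] with π hπ
    exact hπ.energy_eq _
  refine ⟨ρ, ?_, ⟨_, SlowBond.measurable_pathEnergy hT, henergy⟩, fun α hα =>
    ⟨SlowBond.exists_isEntropyConstant hα, fun K₀ hK => ?_⟩⟩
  · filter_upwards [hdens, hfin, henergy] with π h1 h2 h3
    obtain ⟨g, hg⟩ := h1.exists_isWeakDeriv (h3.symm ▸ h2.ne)
    exact ⟨h1, ⟨g, hg⟩, fun i => h1.memL2H1 hg (SlowBond.nextPoint_le_add_one hb hb01 i i)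
      fun u hu => SlowBond.coe_notMem_slowPoints hb hb01 i hu⟩
  · rw [lintegral_congr_ae henergy]
    exact hE.trans (ENNReal.ofReal_le_ofReal (hK.log_two_le hα))
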